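/- A dynamic network on $n$ nodes is a sequence of simple graphs $G^{(0)},G^{(1)},\dots$ on the same $n$ nodes, where $G^{(0)}$ is fixed and $G^{(t)}$, the graph in force during the $t$-th unit of time, may depend on the sets $I_1,\dots,I_t$ of nodes informed up to times $1,\dots,t$. In the asynchronous algorithm one node is informed at time $0$, every node has an independent Poisson clock of rate $1$, and at each tick of its clock a node contacts a uniformly random neighbour in the current graph; if one of the two is informed, then both are informed afterwards. The spread time is the first time at which all nodes are informed. The absolute diligence of a graph $G=(V,E)$ with $E\neq\emptyset$ is $\overline\rho(G)=\min_{\{u,v\}\in E}\max\{1/d_u,1/d_v\}$, where $d_u$ is the degree of $u$ (and $\overline\rho(G)=0$ if $E=\emptyset$). Theorem 4. There are universal constants $c_1,c_2,c,K,C>0$ such that for every integer $n\ge 1$ and every real $\rho$ with $10/n\le\rho\le 1$ there is an $n$-node dynamic network such that (1) whatever informed sets are observed, every graph $G^{(t)}$ is connected and absolutely $\Theta(\rho)$-diligent: $c_1\rho\le\overline\rho(G^{(t)})\le c_2\rho$; (2) whichever node is informed at time $0$, the spread time of the asynchronous algorithm on this network is at least $c\,n/\rho$ with probability at least $1-C/n$;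 (3) the quantity $T_{abs}=\min\{t:\sum_{p=0}^{t}\lceil\Phi(G^{(p)})\rceil\,\overline\rho(G^{(p)})\ge 2n\}$, where $\lceil\Phi(G)\rceil$ is $1$ if $G$ is connected and $0$ otherwise, always satisfies $T_{abs}\le K\,n/\rho$. Hence the lower bound in (2) matches the general upper bound $T_{abs}$ for the spread time up to a constant factor. -/

import Mathlib

open MeasureTheory ProbabilityTheory Filter
open scoped NNReal ENNReal

noncomputable section

namespace Rumor

/-! ## Absolute diligence -/

open Classical in
/-- The absolute diligence `min_{{u,v} ∈ E} max {1/d_u, 1/d_v}` of a finite graph.  The infimum is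
over a finite set, hence a minimum, and it is `0` for a graph without edges. -/
def absDiligence {n : ℕ} (G : SimpleGraph (Fin n)) : ℝ :=
  ⨅ e : {p : Fin n × Fin n // G.Adj p.1 p.2},
    max (1 / (G.degree e.1.1 : ℝ)) (1 / (G.degree e.1.2 : ℝ))

open Classical in
/-- `min {t : ∑_{p ≤ t} ⌈Φ(G^(p))⌉ · absDiligence (G^(p)) ≥ 2 n}`, where `⌈Φ(G)⌉` is `1` if `G` is
connected and `0` otherwise; the value is `⊤` if there is no such `t`. -/
def absTime {n : ℕ} (G : ℕ → SimpleGraph (Fin n)) : ℕ∞ :=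
  ⨅ (t : ℕ) (_ : (2 * n : ℝ) ≤
    ∑ p ∈ Finset.range (t + 1), if (G p).Connected then absDiligence (G p) else 0), (t : ℕ∞)

/-! ## Dynamic networks -/

/-- A dynamic network on the nodes `Fin n`.  The graph exposed at a time step may depend on the
sets of informed nodes observed so far: `net [I_t, …, I_1]` is the graph `G^(t)` that is in force
during the `t`-th unit of time if `I_s` is the set of nodes that are informed up to time `s`.
In particular `net []` is the graph `G^(0)`. -/
abbrev DynamicNetwork (n : ℕ) : Type := List (Finset (Fin n)) → SimpleGraph (Fin n)

/-! ## The asynchronous algorithm, path by path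

`arr v k` is the time of the `k`-th tick of the clock of `v`, and `ch v k S` is the node that `v`
contacts at this tick if its set of neighbours is `S`. -/

open Classical in
/-- In the graph `G`, the node `u` calls its neighbour `v` at time `s`. -/
def Calls {n : ℕ} (G : SimpleGraph (Fin n)) (arr : Fin n → ℕ → ℝ)
    (ch : Fin n → ℕ → Finset (Fin n) → Fin n) (s : ℝ) (u v : Fin n) : Prop :=
  G.Adj u v ∧ ∃ k, arr u k = s ∧ ch u k (G.neighborFinset u) = v

/-- `Learns G arr ch S a v s`: if the nodes of `S` know the rumor at time `a` and the graph is `G`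
from then on, then a chain of calls, each a push or a pull, passes the rumor to `v` at time `s`. -/
inductive Learns {n : ℕ} (G : SimpleGraph (Fin n)) (arr : Fin n → ℕ → ℝ)
    (ch : Fin n → ℕ → Finset (Fin n) → Fin n) (S : Finset (Fin n)) (a : ℝ) : Fin n → ℝ → Prop
  | start {v : Fin n} : v ∈ S → Learns G arr ch S a v a
  | push {u v : Fin n} {s s' : ℝ} : Learns G arr ch S a u s → s < s' →
      Calls G arr ch s' u v → Learns G arr ch S a v s'
  | pull {u v : Fin n} {s s' : ℝ} : Learns G arr ch S a u s → s < s' →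
      Calls G arr ch s' v u → Learns G arr ch S a v s'

open Classical in
/-- The nodes that know the rumor at time `b` if those of `S` know it at time `a ≤ b` and the graph
is `G` during `(a, b]`. -/
def advance {n : ℕ} (G : SimpleGraph (Fin n)) (arr : Fin n → ℕ → ℝ)
    (ch : Fin n → ℕ → Finset (Fin n) → Fin n) (S : Finset (Fin n)) (a b : ℝ) : Finset (Fin n) :=
  {v | ∃ s ≤ b, Learns G arr ch S a v s}

/-- The pair `(I_t, [I_t, …, I_1])` at the integer time `t`, where `I_0 = {v₀}`. -/
def state {n : ℕ} (net : DynamicNetwork n) (v₀ : Fin n) (arr : Fin n → ℕ → ℝ)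
    (ch : Fin n → ℕ → Finset (Fin n) → Fin n) : ℕ → Finset (Fin n) × List (Finset (Fin n))
  | 0 => ({v₀}, [])
  | t + 1 =>
      let p := state net v₀ arr ch t
      let J := advance (net p.2) arr ch p.1 t (t + 1)
      (J, J :: p.2)

/-- The graph `G^(t)` in force during the `t`-th unit of time. -/
def graphAt {n : ℕ} (net : DynamicNetwork n) (v₀ : Fin n) (arr : Fin n → ℕ → ℝ)
    (ch : Fin n → ℕ → Finset (Fin n) → Fin n) (t : ℕ) : SimpleGraph (Fin n) :=
  net (state net v₀ arr ch t).2

/-- The set of nodes informed up to the real time `τ`. -/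
def informed {n : ℕ} (net : DynamicNetwork n) (v₀ : Fin n) (arr : Fin n → ℕ → ℝ)
    (ch : Fin n → ℕ → Finset (Fin n) → Fin n) (τ : ℝ≥0) : Finset (Fin n) :=
  advance (graphAt net v₀ arr ch ⌊τ⌋₊) arr ch (state net v₀ arr ch ⌊τ⌋₊).1 ⌊τ⌋₊ τ

/-- The first time at which all nodes are informed (`∞` if there is none). -/
def spreadTime {n : ℕ} (net : DynamicNetwork n) (v₀ : Fin n) (arr : Fin n → ℕ → ℝ)
    (ch : Fin n → ℕ → Finset (Fin n) → Fin n) : ℝ≥0∞ :=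
  ⨅ (τ : ℝ≥0) (_ : informed net v₀ arr ch τ = Finset.univ), (τ : ℝ≥0∞)

/-! ## The randomness -/

/-- The number of arrivals up to time `t`. -/
def count {Ω : Type*} (arr : ℕ → Ω → ℝ) (t : ℝ≥0) (ω : Ω) : ℕ :=
  {k : ℕ | arr k ω ≤ t}.ncard

/-- `arr 0 < arr 1 < …` are the arrival times of a Poisson process with rate `1`. -/
structure IsPoissonClock {Ω : Type*} [MeasurableSpace Ω] (P : Measure Ω)
    (arr : ℕ → Ω → ℝ) : Prop where
  measurable : ∀ k, Measurable (arr k)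
  pos : ∀ᵐ ω ∂P, 0 < arr 0 ω
  strictMono : ∀ᵐ ω ∂P, StrictMono fun k => arr k ω
  tendsto : ∀ᵐ ω ∂P, Tendsto (fun k => arr k ω) atTop atTop
  law : ∀ a b : ℝ≥0, a ≤ b →
    HasLaw (fun ω => count arr b ω - count arr a ω) (poissonMeasure (b - a)) P
  indep : HasIndepIncrements (count arr) P

/-- The randomness of the algorithm: the nodes have independent Poisson clocks of rate `1`, and
independently of the clocks and of all other choices, the node contacted by `v` at its `k`-th tick
is uniformly distributed on the set `S` of the current neighbours of `v`. -/
structure IsAsyncRandomness {n : ℕ} {Ω : Type*} [MeasurableSpace Ω] (P : Measure Ω)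
    (arr : Fin n → ℕ → Ω → ℝ) (ch : Fin n → ℕ → Ω → Finset (Fin n) → Fin n) : Prop where
  clock : ∀ v, IsPoissonClock P (arr v)
  clock_indep : iIndepFun (fun v ω k => arr v k ω) P
  choice_measurable : ∀ v k, Measurable (ch v k)
  choice_uniform : ∀ v k (S : Finset (Fin n)), ∀ w ∈ S,
    P {ω | ch v k ω S = w} = (S.card : ℝ≥0∞)⁻¹
  choice_indep : iIndepFun (fun (p : Fin n × ℕ) ω => ch p.1 p.2 ω) P
  clock_choice_indep : IndepFun (fun ω v k => arr v k ω) (fun ω v k => ch v k ω) P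

end Rumor

end

/-! Put `D = ⌈1/ρ⌉`. At every integer time the adversary encloses all nodes seen to be informed in a
set `A` (the `barrier`) and exposes a connected graph with all degrees in `[D, 2D]` in which only
one edge leaves `A`. All degrees being of order `1/ρ`, the absolute diligence is of order `ρ`, which
also bounds `T_abs`. The rumor crosses the bridge at rate at most `2/D`. Once `Y` nodes outside `A`
know it, new outside nodes are informed at rate at most `3Y + 2/D` (`IsBottleneck.sum_crosses_le`).
So a unit of time usually adds nothing to `A`, and with probability `O(1/D)` it starts a branching
growth that lasts for at most one unit. Filling up `A` should thus take time of order `n D`, that is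
`n/ρ`.

A bound on the mean of `|A|` would only give a constant probability, so an exponential moment is
used. Up to a cap, the potential is `(1 + eps)^max(|A|, D + 1)` times a weight for the outside
nodes. The weight depends on the time left in the current unit so that it does not grow in
expectation within the unit (`weight_drift_le`). Moving the outside nodes into `A` at the end of the
unit costs a factor `1 + 4/D` (`potential_cons_le`). After `T` units the mean potential is at most
`(1 + 4/D)^T` times its initial bound. For `T` a small multiple of `n D` this is exponentially
smaller than `(1 + eps)^(n - D)`, the value forced by full spread, and Markov's inequality applies.

To avoid continuous-time martingales, each unit is cut into `M` intervals, and the simulation `run`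
carries out a call only in intervals with exactly one tick. It agrees with the process unless some
interval has two ticks (`run_eq_state`), which has probability at most `1/n` for large `M`. Given
the past of the simulation, a prescribed call of `u` has probability at most `1/M` times the inverse
degree of `u` (`IsAsyncRandomness.measure_run_call_le`). -/

noncomputable section

namespace Rumor

open Classical

variable {n : ℕ}

/-! ## A simulation on a fine time grid -/

/-- The informed nodes after a time interval in which `v` has `N v` ticks: if there is exactly one
tick, the corresponding call is carried out; otherwise nothing happens. -/
def step (G : SimpleGraph (Fin n)) (S : Finset (Fin n)) (N : Fin n → ℕ)
    (c : Fin n → Finset (Fin n) → Fin n) : Finset (Fin n) :=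
  if ∑ v, N v = 1 then
    Finset.univ.filter fun v => v ∈ S ∨ ∃ x ∈ S, G.Adj x v ∧
      ((N x ≠ 0 ∧ c x (G.neighborFinset x) = v) ∨ (N v ≠ 0 ∧ c v (G.neighborFinset v) = x))
  else S

/-- The informed set and the history after `j` grid intervals, `M` of which make a unit of time. -/
def run (net : DynamicNetwork n) (v₀ : Fin n) (M : ℕ) (N : ℕ → Fin n → ℕ)
    (ch : Fin n → ℕ → Finset (Fin n) → Fin n) : ℕ → Finset (Fin n) × List (Finset (Fin n))
  | 0 => ({v₀}, [])
  | j + 1 =>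
      let p := run net v₀ M N ch j
      let J := step (net p.2) p.1 (N j) fun v => ch v (∑ i ∈ Finset.range j, N i v)
      (J, if M ∣ j + 1 then J :: p.2 else p.2)

/-- A choice matters only if its node ticks in the interval at hand, and then its index is below the
number of ticks up to the end of that interval. This makes the past of the simulation a function of
finitely many choices, once the ticks are fixed. -/
theorem run_congr (net : DynamicNetwork n) (v₀ : Fin n) (M : ℕ) {N N' : ℕ → Fin n → ℕ}
    {ch ch' : Fin n → ℕ → Finset (Fin n) → Fin n} (j : ℕ) (hN : ∀ i < j, N i = N' i)
    (hch : ∀ v, ∀ k < ∑ i ∈ Finset.range j, N i v, ch v k = ch' v k) :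
    run net v₀ M N ch j = run net v₀ M N' ch' j := by
  induction j with
  | zero => rfl
  | succ j ih =>
    have h1 := ih (fun i hi => hN i (by omega)) (fun v k hk => hch v k (by
      rw [Finset.sum_range_succ]; omega))
    have h2 : ∀ v, ∑ i ∈ Finset.range j, N' i v = ∑ i ∈ Finset.range j, N i v := fun v =>
      Finset.sum_congr rfl fun i hi => by
        rw [hN i (by have := Finset.mem_range.1 hi; omega)]
    have h3 : ∀ (G : SimpleGraph (Fin n)) S,
        step G S (N j) (fun v => ch v (∑ i ∈ Finset.range j, N i v)) =
        step G S (N' j) (fun v => ch' v (∑ i ∈ Finset.range j, N' i v)) := by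
      intro G S
      rw [← hN j (by omega)]
      have h4 : ∀ v, N j v ≠ 0 → ch' v (∑ i ∈ Finset.range j, N' i v) =
          ch v (∑ i ∈ Finset.range j, N i v) := fun v hv => by
        rw [h2, hch v]
        rw [Finset.sum_range_succ]; omega
      unfold step
      split_ifs with hs
      · ext v
        simp only [Finset.mem_filter, Finset.mem_univ, true_and]
        refine or_congr_right (exists_congr fun x => and_congr_right fun _ =>
          and_congr_right fun _ => or_congr (and_congr_right fun h => ?_)
            (and_congr_right fun h => ?_)) <;> rw [h4 _ h]
      · rfl
    simp only [run, h1, h3]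

/-! ## Composition in time -/

section
variable {G : SimpleGraph (Fin n)} {arr : Fin n → ℕ → ℝ}
  {ch : Fin n → ℕ → Finset (Fin n) → Fin n} {S : Finset (Fin n)} {a b c : ℝ}

theorem Learns.le {v : Fin n} {s : ℝ} (h : Learns G arr ch S a v s) : a ≤ s := by
  induction h with
  | start _ => exact le_rfl
  | push _ h _ ih => exact ih.trans h.le
  | pull _ h _ ih => exact ih.trans h.le

theorem mem_advance {v : Fin n} :
    v ∈ advance G arr ch S a b ↔ ∃ s ≤ b, Learns G arr ch S a v s := by
  simp [advance]

theorem advance_mono (h : b ≤ c) : advance G arr ch S a b ⊆ advance G arr ch S a c := by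
  intro v hv
  obtain ⟨s, hs, hv⟩ := mem_advance.1 hv
  exact mem_advance.2 ⟨s, hs.trans h, hv⟩

theorem subset_advance (h : a ≤ b) : S ⊆ advance G arr ch S a b := fun _ hv =>
  mem_advance.2 ⟨a, h, .start hv⟩

theorem advance_self : advance G arr ch S a a = S := by
  refine subset_antisymm (fun v hv => ?_) (subset_advance le_rfl)
  obtain ⟨s, hs, hv⟩ := mem_advance.1 hv
  cases hv with
  | start h => exact h
  | push h1 h2 _ => exact absurd (h1.le.trans_lt h2) hs.not_gt
  | pull h1 h2 _ => exact absurd (h1.le.trans_lt h2) hs.not_gt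

/-- A chain of calls can be cut at time `b`: the last node reached by then restarts it. -/
theorem advance_advance (hab : a ≤ b) (hbc : b ≤ c) :
    advance G arr ch (advance G arr ch S a b) b c = advance G arr ch S a c := by
  ext v
  constructor
  · intro hv
    obtain ⟨s, hs, hv⟩ := mem_advance.1 hv
    have key : ∀ v s, Learns G arr ch (advance G arr ch S a b) b v s →
        ∃ s' ≤ s, Learns G arr ch S a v s' := by
      intro v s h
      induction h with
      | start h => exact mem_advance.1 h
      | push _ h2 h3 ih =>
        obtain ⟨s', hs', h⟩ := ih
        exact ⟨_, le_rfl, .push h (hs'.trans_lt h2) h3⟩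
      | pull _ h2 h3 ih =>
        obtain ⟨s', hs', h⟩ := ih
        exact ⟨_, le_rfl, .pull h (hs'.trans_lt h2) h3⟩
    obtain ⟨s', hs', h⟩ := key v s hv
    exact mem_advance.2 ⟨s', hs'.trans hs, h⟩
  · intro hv
    obtain ⟨s, hs, hv⟩ := mem_advance.1 hv
    have key : ∀ v s, Learns G arr ch S a v s → b < s →
        Learns G arr ch (advance G arr ch S a b) b v s := by
      intro v s h
      induction h with
      | start h => exact fun h' => absurd h' hab.not_gt
      | @push u v s s' h1 h2 h3 ih =>
        intro hb
        rcases le_or_gt s b with h | h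
        · exact .push (.start (mem_advance.2 ⟨s, h, h1⟩)) hb h3
        · exact .push (ih h) h2 h3
      | @pull u v s s' h1 h2 h3 ih =>
        intro hb
        rcases le_or_gt s b with h | h
        · exact .pull (.start (mem_advance.2 ⟨s, h, h1⟩)) hb h3
        · exact .pull (ih h) h2 h3
    rcases le_or_gt s b with h | h
    · exact subset_advance hbc (mem_advance.2 ⟨s, h, hv⟩)
    · exact mem_advance.2 ⟨s, hs, key v s hv h⟩

/-- If there is at most one tick during `(b, c]`, then `step` describes what happens. -/
theorem advance_eq_step {K N : Fin n → ℕ} (hbc : b ≤ c)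
    (hN : ∀ v k, b < arr v k ∧ arr v k ≤ c ↔ K v ≤ k ∧ k < K v + N v) (h1 : ∑ v, N v ≤ 1) :
    advance G arr ch S b c = step G S N fun v => ch v (K v) := by
  have huniq : ∀ u k u' k', b < arr u k → arr u k ≤ c → b < arr u' k' → arr u' k' ≤ c →
      arr u k = arr u' k' := by
    intro u k u' k' h2 h3 h4 h5
    obtain ⟨h6, h7⟩ := (hN u k).1 ⟨h2, h3⟩
    obtain ⟨h8, h9⟩ := (hN u' k').1 ⟨h4, h5⟩
    by_cases h : u = u'
    · subst h
      have := Finset.single_le_sum (f := N) (fun _ _ => Nat.zero_le _) (Finset.mem_univ u)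
      have : k = k' := by omega
      rw [this]
    · have := Finset.add_le_sum (f := N) (fun _ _ => Nat.zero_le _) (Finset.mem_univ u)
        (Finset.mem_univ u') h
      omega
  have hpos : ∀ u, N u ≠ 0 → ∑ v, N v = 1 := by
    intro u hu
    have := Finset.single_le_sum (f := N) (fun _ _ => Nat.zero_le _) (Finset.mem_univ u)
    omega
  have hK : ∀ u k, b < arr u k → arr u k ≤ c → N u ≠ 0 ∧ k = K u := by
    intro u k h2 h3
    obtain ⟨h6, h7⟩ := (hN u k).1 ⟨h2, h3⟩
    have := Finset.single_le_sum (f := N) (fun _ _ => Nat.zero_le _) (Finset.mem_univ u)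
    omega
  -- Successive calls of a chain have distinct times, and all ticks in `(b, c]` coincide. Hence a
  -- node that learned before the tick was in `S` from the start, and chains have at most one call.
  have hfirst : ∀ u s, Learns G arr ch S b u s → ∀ s', s < s' → s' ≤ c →
      (∃ v k, arr v k = s') → u ∈ S := by
    intro u s h s' hs hs' hv
    obtain ⟨v, k, rfl⟩ := hv
    have hb := h.le
    cases h with
    | start h => exact h
    | push h2 h3 h4 =>
      obtain ⟨_, k', rfl, _⟩ := h4
      exact absurd (huniq _ _ _ _ (h2.le.trans_lt h3) (hs.le.trans hs') (hb.trans_lt hs) hs') hs.ne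
    | pull h2 h3 h4 =>
      obtain ⟨_, k', rfl, _⟩ := h4
      exact absurd (huniq _ _ _ _ (h2.le.trans_lt h3) (hs.le.trans hs') (hb.trans_lt hs) hs') hs.ne
  ext v
  rw [mem_advance]
  constructor
  · rintro ⟨s, hs, h⟩
    cases h with
    | start h => unfold step; split_ifs <;> simp [h]
    | @push u _ s' _ h2 h3 h4 =>
      obtain ⟨hG, k, rfl, h5⟩ := h4
      have hu := hfirst _ _ h2 _ h3 hs ⟨_, _, rfl⟩
      obtain ⟨h6, rfl⟩ := hK u k (h2.le.trans_lt h3) hs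
      rw [step, if_pos (hpos u h6)]
      simp only [Finset.mem_filter, Finset.mem_univ, true_and]
      exact Or.inr ⟨u, hu, hG, Or.inl ⟨h6, h5⟩⟩
    | @pull u _ s' _ h2 h3 h4 =>
      obtain ⟨hG, k, rfl, h5⟩ := h4
      have hu := hfirst _ _ h2 _ h3 hs ⟨_, _, rfl⟩
      obtain ⟨h6, rfl⟩ := hK v k (h2.le.trans_lt h3) hs
      rw [step, if_pos (hpos v h6)]
      simp only [Finset.mem_filter, Finset.mem_univ, true_and]
      exact Or.inr ⟨u, hu, hG.symm, Or.inr ⟨h6, h5⟩⟩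
  · intro hv
    by_cases hvS : v ∈ S
    · exact ⟨b, hbc, .start hvS⟩
    unfold step at hv
    split_ifs at hv with hs
    swap
    · exact absurd hv hvS
    simp only [Finset.mem_filter, Finset.mem_univ, true_and] at hv
    obtain ⟨x, hx, hG, h | h⟩ := hv.resolve_left hvS
    · obtain ⟨h2, h3⟩ := (hN x (K x)).2 ⟨le_rfl, by omega⟩
      exact ⟨_, h3, .push (.start hx) h2 ⟨hG, _, rfl, h.2⟩⟩
    · obtain ⟨h2, h3⟩ := (hN v (K v)).2 ⟨le_rfl, by omega⟩
      exact ⟨_, h3, .pull (.start hx) h2 ⟨hG.symm, _, rfl, h.2⟩⟩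

end

/-! ## Counting ticks -/

/-- The number of terms of the sequence `x` that are at most `t`. -/
def cnt (x : ℕ → ℝ) (t : ℝ≥0) : ℕ := {k : ℕ | x k ≤ t}.ncard

/-- The indices of arrivals up to `t` form an initial segment of `ℕ`, so its length encodes all
comparisons with `t`. -/
theorem lt_cnt_iff {x : ℕ → ℝ} (hx : StrictMono x) (hlim : Tendsto x atTop atTop) (t : ℝ≥0)
    (k : ℕ) : k < cnt x t ↔ x k ≤ t := by
  obtain ⟨m, hm⟩ := (hlim.eventually_gt_atTop (t : ℝ)).exists
  have hex : ∃ m, (t : ℝ) < x m := ⟨m, hm⟩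
  have : {k : ℕ | x k ≤ t} = Set.Iio (Nat.find hex) := by
    ext k
    simp only [Set.mem_ofPred_eq, Set.mem_Iio]
    constructor
    · intro h
      by_contra hk
      exact absurd (Nat.find_spec hex) ((hx.monotone (not_lt.1 hk)).trans h).not_gt
    · intro h
      exact not_lt.1 (Nat.find_min hex h)
  have h2 : cnt x t = Nat.find hex := by
    rw [cnt, this, ← Finset.coe_Iio, Set.ncard_coe_finset, Nat.card_Iio]
  rw [h2, Nat.lt_find_iff]
  constructor
  · exact fun h => not_lt.1 (h k le_rfl)
  · exact fun h m hm => not_lt.2 ((hx.monotone hm).trans h)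

/-- The point number `j` of the grid with `M` points per unit of time. -/
def grid (M j : ℕ) : ℝ≥0 := j / M

theorem grid_mono (M : ℕ) : Monotone (grid M) := fun i j h => by
  unfold grid
  gcongr

/-- The number of ticks of `v` in the grid interval number `j`. -/
def ticks (M : ℕ) (arr : Fin n → ℕ → ℝ) (j : ℕ) (v : Fin n) : ℕ :=
  cnt (arr v) (grid M (j + 1)) - cnt (arr v) (grid M j)

/-- The qualitative properties that the tick times have almost surely. -/
structure RegularTicks (arr : Fin n → ℕ → ℝ) : Prop where
  pos : ∀ v, 0 < arr v 0
  strictMono : ∀ v, StrictMono (arr v)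
  tendsto : ∀ v, Tendsto (arr v) atTop atTop

theorem RegularTicks.cnt_mono {arr : Fin n → ℕ → ℝ} (h : RegularTicks arr) (v : Fin n) :
    Monotone (cnt (arr v)) := by
  intro s t hst
  by_contra hc
  have h1 := (lt_cnt_iff (h.strictMono v) (h.tendsto v) s _).1 (not_le.1 hc)
  have h2 := (lt_cnt_iff (h.strictMono v) (h.tendsto v) t _).2 (h1.trans (by exact_mod_cast hst))
  exact absurd h2 (lt_irrefl _)

theorem RegularTicks.sum_ticks {arr : Fin n → ℕ → ℝ} (h : RegularTicks arr) (M j : ℕ)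
    (v : Fin n) : ∑ i ∈ Finset.range j, ticks M arr i v = cnt (arr v) (grid M j) := by
  induction j with
  | zero =>
    have : ¬ 0 < cnt (arr v) (grid M 0) := by
      rw [lt_cnt_iff (h.strictMono v) (h.tendsto v)]
      simpa [grid] using h.pos v
    simp; omega
  | succ j ih =>
    rw [Finset.sum_range_succ, ih, ticks]
    have := h.cnt_mono v (grid_mono M (Nat.le_add_right j 1))
    omega

/-- This is the hypothesis on indices that `advance_eq_step` needs for one grid interval. -/
theorem RegularTicks.mem_interval_iff {arr : Fin n → ℕ → ℝ} (h : RegularTicks arr) (M j : ℕ)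
    (v : Fin n) (k : ℕ) : ((grid M j : ℝ) < arr v k ∧ arr v k ≤ grid M (j + 1)) ↔
      ∑ i ∈ Finset.range j, ticks M arr i v ≤ k ∧
        k < ∑ i ∈ Finset.range j, ticks M arr i v + ticks M arr j v := by
  rw [← Finset.sum_range_succ (fun i => ticks M arr i v), h.sum_ticks, h.sum_ticks,
    lt_cnt_iff (h.strictMono v) (h.tendsto v)]
  refine and_congr_left fun _ => ?_
  rw [← not_iff_not, not_lt, not_le, lt_cnt_iff (h.strictMono v) (h.tendsto v)]

/-- Inside a unit of time the graph is fixed, so single steps compose by `advance_advance`. The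
restriction `i < M` stops just before the history is extended. -/
theorem run_eq_advance (net : DynamicNetwork n) (v₀ : Fin n) {M : ℕ}
    {arr : Fin n → ℕ → ℝ} (ch : Fin n → ℕ → Finset (Fin n) → Fin n) (h : RegularTicks arr)
    {T : ℕ} (h1 : ∀ j < T * M, ∑ v, ticks M arr j v ≤ 1) {t : ℕ} (ht : t < T)
    (hrun : run net v₀ M (ticks M arr) ch (t * M) = state net v₀ arr ch t) (i : ℕ) (hi : i < M) :
    run net v₀ M (ticks M arr) ch (t * M + i) =
      (advance (graphAt net v₀ arr ch t) arr ch (state net v₀ arr ch t).1 (grid M (t * M))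
        (grid M (t * M + i)), (state net v₀ arr ch t).2) := by
  have hlt : ∀ i < M, t * M + i < T * M := fun i hi => by nlinarith
  induction i with
  | zero => rw [add_zero, advance_self, hrun]
  | succ i ih =>
    have hdvd : ¬ M ∣ t * M + i + 1 := by
      rw [add_assoc, Nat.dvd_add_right (Dvd.intro_left t rfl)]
      exact fun hd => absurd (Nat.le_of_dvd (by omega) hd) (by omega)
    rw [← add_assoc]
    simp only [run]
    rw [ih (by omega), if_neg hdvd]
    congr 1
    rw [← advance_advance (b := grid M (t * M + i)) (c := grid M (t * M + i + 1))]
    · exact (advance_eq_step (by exact_mod_cast grid_mono M (Nat.le_succ _))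
        (fun v k => h.mem_interval_iff M (t * M + i) v k) (h1 _ (hlt i (by omega)))).symm
    · exact_mod_cast grid_mono M (by omega)
    · exact_mod_cast grid_mono M (by omega)

/-- If no grid interval contains two ticks, then the simulation is exact. -/
theorem run_eq_state (net : DynamicNetwork n) (v₀ : Fin n) {M : ℕ} (hM : 0 < M)
    {arr : Fin n → ℕ → ℝ} (ch : Fin n → ℕ → Finset (Fin n) → Fin n) (h : RegularTicks arr)
    {T : ℕ} (h1 : ∀ j < T * M, ∑ v, ticks M arr j v ≤ 1) (t : ℕ) (ht : t ≤ T) :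
    run net v₀ M (ticks M arr) ch (t * M) = state net v₀ arr ch t := by
  induction t with
  | zero => simp [run, state]
  | succ t ih =>
    have h2 := run_eq_advance net v₀ ch h h1 ht (ih (by omega)) (M - 1) (by omega)
    have h3 : (t + 1) * M = t * M + (M - 1) + 1 := by
      rw [add_mul]; omega
    have hg : ∀ t : ℕ, ((grid M (t * M) : ℝ≥0) : ℝ) = t := fun t => by
      have : (M : ℝ) ≠ 0 := by positivity
      simp [grid, this]
    have hlt : t * M + (M - 1) < T * M := by
      have : (t + 1) * M ≤ T * M := Nat.mul_le_mul_right _ ht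
      omega
    have hadv : advance (graphAt net v₀ arr ch t) arr ch (state net v₀ arr ch t).1 t (t + 1) =
        step (graphAt net v₀ arr ch t) (advance (graphAt net v₀ arr ch t) arr ch
          (state net v₀ arr ch t).1 (grid M (t * M)) (grid M (t * M + (M - 1))))
          (ticks M arr (t * M + (M - 1)))
          (fun v => ch v (∑ i ∈ Finset.range (t * M + (M - 1)), ticks M arr i v)) := by
      rw [← advance_eq_step (by exact_mod_cast grid_mono M (Nat.le_succ _))
        (fun v k => h.mem_interval_iff M _ v k) (h1 _ hlt), advance_advance, ← h3, hg, hg]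
      · push_cast; rfl
      · exact_mod_cast grid_mono M (by omega)
      · exact_mod_cast grid_mono M (by omega)
    rw [h3]
    simp only [run]
    rw [h2, if_pos (h3 ▸ Dvd.intro_left _ rfl)]
    simp only [state]
    rw [show net (state net v₀ arr ch t).2 = graphAt net v₀ arr ch t from rfl, hadv]

/-- If the rumor has spread before time `T`, then everyone is informed at time `T` at the latest. -/
theorem exists_state_eq_univ_of_spreadTime_lt {net : DynamicNetwork n} {v₀ : Fin n}
    {arr : Fin n → ℕ → ℝ} {ch : Fin n → ℕ → Finset (Fin n) → Fin n} {T : ℕ}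
    (h : spreadTime net v₀ arr ch < T) :
    ∃ t < T, (state net v₀ arr ch (t + 1)).1 = Finset.univ := by
  unfold spreadTime at h
  simp only [iInf_lt_iff] at h
  obtain ⟨τ, hτ, hlt⟩ := h
  have hlt' : τ < (T : ℝ≥0) := by exact_mod_cast hlt
  -- The infimum in `spreadTime` need not be attained, but some `τ < T` has everyone informed, and
  -- rounding `τ` up to the next integer stays within `T`.
  refine ⟨⌊τ⌋₊, (Nat.floor_lt (zero_le)).2 hlt', ?_⟩
  rw [Finset.eq_univ_iff_forall]
  intro v
  have hv : v ∈ informed net v₀ arr ch τ := hτ ▸ Finset.mem_univ v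
  simp only [state]
  refine advance_mono ?_ hv
  exact_mod_cast (Nat.lt_floor_add_one τ).le

/-! ## The law of the ticks -/

/-- The set of early arrivals equals a given finite set on a countable intersection of measurable
events, and there are only countably many finite sets. -/
theorem measurable_cnt (t : ℝ≥0) : Measurable fun x : ℕ → ℝ => cnt x t := by
  set E : Finset ℕ → Set (ℕ → ℝ) := fun F => {x | {k : ℕ | x k ≤ t} = F} with hE
  have hEm : ∀ F, MeasurableSet (E F) := fun F => by
    have : E F = ⋂ k : ℕ, if k ∈ F then {x : ℕ → ℝ | x k ≤ t} else {x : ℕ → ℝ | x k ≤ t}ᶜ := by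
      ext x
      simp only [hE, Set.mem_ofPred_eq, Set.ext_iff, Set.mem_iInter, Finset.mem_coe]
      refine forall_congr' fun k => ?_
      split_ifs with h <;> simp [h]
    rw [this]
    refine MeasurableSet.iInter fun k => ?_
    have : MeasurableSet {x : ℕ → ℝ | x k ≤ t} :=
      measurableSet_le (measurable_pi_apply k) measurable_const
    split_ifs
    exacts [this, this.compl]
  have hfin : MeasurableSet {x : ℕ → ℝ | {k : ℕ | x k ≤ t}.Finite} := by
    have : {x : ℕ → ℝ | {k : ℕ | x k ≤ t}.Finite} = ⋃ F, E F := by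
      ext x
      simp only [Set.mem_iUnion, Set.mem_ofPred_eq, hE]
      exact ⟨fun h => ⟨h.toFinset, by simp⟩, fun ⟨F, hF⟩ => hF ▸ F.finite_toSet⟩
    rw [this]
    exact MeasurableSet.iUnion hEm
  refine measurable_to_countable' fun m => ?_
  -- `Set.ncard` is `0` on infinite sets, so infinitely many early arrivals contribute to `m = 0`.
  have : (fun x : ℕ → ℝ => cnt x t) ⁻¹' {m} = (⋃ F : {F : Finset ℕ // F.card = m}, E F) ∪
      ({x : ℕ → ℝ | {k : ℕ | x k ≤ t}.Finite}ᶜ ∩ {_x | m = 0}) := by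
    ext x
    simp only [Set.mem_preimage, Set.mem_singleton_iff, Set.mem_union, Set.mem_iUnion,
      Set.mem_inter_iff, Set.mem_compl_iff, Set.mem_ofPred_eq, hE]
    constructor
    · intro h
      by_cases hf : {k : ℕ | x k ≤ t}.Finite
      · refine Or.inl ⟨⟨hf.toFinset, ?_⟩, by simp⟩
        rw [← h, cnt, Set.ncard_eq_toFinset_card _ hf]
      · exact Or.inr ⟨hf, by rw [← h, cnt, Set.Infinite.ncard hf]⟩
    · rintro (⟨⟨F, hF⟩, h⟩ | ⟨h, h0⟩)
      · rw [cnt, h, Set.ncard_coe_finset, hF]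
      · rw [cnt, Set.Infinite.ncard h, h0]
  rw [this]
  exact (MeasurableSet.iUnion fun F => hEm _).union (hfin.compl.inter (MeasurableSet.const _))

theorem measurable_ticks (M j : ℕ) (v : Fin n) :
    Measurable fun x : Fin n → ℕ → ℝ => ticks M x j v :=
  ((measurable_cnt _).comp (measurable_pi_apply v)).sub
    ((measurable_cnt _).comp (measurable_pi_apply v))

section
variable {Ω : Type*} {arr : Fin n → ℕ → Ω → ℝ} {ch : Fin n → ℕ → Ω → Finset (Fin n) → Fin n}

theorem IsAsyncRandomness.ae_regularTicks [MeasurableSpace Ω] {P : Measure Ω}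
    (hR : IsAsyncRandomness P arr ch) :
    ∀ᵐ ω ∂P, RegularTicks fun v k => arr v k ω := by
  filter_upwards [ae_all_iff.2 fun v => (hR.clock v).pos,
    ae_all_iff.2 fun v => (hR.clock v).strictMono,
    ae_all_iff.2 fun v => (hR.clock v).tendsto] with ω h1 h2 h3
  exact ⟨h1, h2, h3⟩

theorem IsAsyncRandomness.measurable_arr [MeasurableSpace Ω] {P : Measure Ω}
    (hR : IsAsyncRandomness P arr ch) :
    Measurable fun ω v k => arr v k ω :=
  measurable_pi_lambda _ fun v => measurable_pi_lambda _ fun k => (hR.clock v).measurable k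

theorem IsAsyncRandomness.measurable_ch [MeasurableSpace Ω] {P : Measure Ω}
    (hR : IsAsyncRandomness P arr ch) :
    Measurable fun ω v k => ch v k ω :=
  measurable_pi_lambda _ fun v => measurable_pi_lambda _ fun k => hR.choice_measurable v k

/-- The number of ticks of `v` in the grid interval number `j`, as a random variable. -/
def rticks (M : ℕ) (arr : Fin n → ℕ → Ω → ℝ) (j : ℕ) (v : Fin n) (ω : Ω) : ℕ :=
  ticks M (fun v k => arr v k ω) j v

theorem IsAsyncRandomness.measurable_rticks [MeasurableSpace Ω] {P : Measure Ω}
    (hR : IsAsyncRandomness P arr ch) (M j : ℕ)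
    (v : Fin n) : Measurable (rticks M arr j v) :=
  (measurable_ticks M j v).comp hR.measurable_arr

theorem grid_sub {M : ℕ} (j : ℕ) : grid M (j + 1) - grid M j = 1 / M := by
  rw [grid, grid, ← NNReal.sub_div]
  congr 1
  push_cast
  rw [add_tsub_cancel_left]

theorem IsAsyncRandomness.rticks_law [MeasurableSpace Ω] {P : Measure Ω}
    (hR : IsAsyncRandomness P arr ch) (M j : ℕ) (v : Fin n) :
    HasLaw (rticks M arr j v) (poissonMeasure (1 / M)) P := by
  have := (hR.clock v).law _ _ (grid_mono M (Nat.le_add_right j 1))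
  rwa [grid_sub] at this

theorem IsAsyncRandomness.measure_rticks_ne_zero [MeasurableSpace Ω] {P : Measure Ω}
    (hR : IsAsyncRandomness P arr ch) (M j : ℕ)
    (v : Fin n) : P (rticks M arr j v ⁻¹' {0}ᶜ) ≤ ENNReal.ofReal (1 / M) := by
  have h : P (rticks M arr j v ⁻¹' {0}ᶜ) = poissonMeasure (1 / M) {0}ᶜ := by
    rw [← (hR.rticks_law M j v).map_eq, Measure.map_apply (hR.measurable_rticks M j v)
      (by measurability)]
  rw [h, prob_compl_eq_one_sub (by measurability), poissonMeasure_singleton,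
    ← ENNReal.ofReal_one, ← ENNReal.ofReal_sub _ (by positivity)]
  refine ENNReal.ofReal_le_ofReal ?_
  have := Real.add_one_le_exp (-(1 / M : ℝ))
  simp
  simp at this
  linarith

/-- With `x = 1/M` the probability is `1 - exp(-x)(1 + x)`, and `exp(-x) ≥ 1 - x`. -/
theorem IsAsyncRandomness.measure_two_le_rticks [MeasurableSpace Ω] {P : Measure Ω}
    (hR : IsAsyncRandomness P arr ch) (M j : ℕ)
    (v : Fin n) : P {ω | 2 ≤ rticks M arr j v ω} ≤ ENNReal.ofReal ((1 / M) ^ 2) := by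
  have h : P {ω | 2 ≤ rticks M arr j v ω} = poissonMeasure (1 / M) ({0, 1} : Set ℕ)ᶜ := by
    rw [← (hR.rticks_law M j v).map_eq, Measure.map_apply (hR.measurable_rticks M j v)
      (by measurability)]
    congr 1
    ext ω
    simp
    omega
  have h2 : poissonMeasure (1 / M) ({0, 1} : Set ℕ) =
      ENNReal.ofReal (Real.exp (-(1 / M)) * (1 + 1 / M)) := by
    rw [Set.insert_eq, measure_union (by simp) (by measurability), poissonMeasure_singleton,
      poissonMeasure_singleton, ← ENNReal.ofReal_add (by positivity) (by positivity)]
    congr 1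
    simp
    ring
  rw [h, prob_compl_eq_one_sub (by measurability), h2,
    ← ENNReal.ofReal_one, ← ENNReal.ofReal_sub _ (by positivity)]
  refine ENNReal.ofReal_le_ofReal ?_
  have := Real.add_one_le_exp (-(1 / M : ℝ))
  have h3 : (0 : ℝ) ≤ 1 / M := by positivity
  nlinarith

/-- Two ticks come either from one node or from two independent nodes. Each of the `n ^ 2` ordered
pairs costs at most `(1/M)^2`. -/
theorem IsAsyncRandomness.measure_two_le_sum_rticks [MeasurableSpace Ω] {P : Measure Ω}
    (hR : IsAsyncRandomness P arr ch) (M j : ℕ) :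
    P {ω | 2 ≤ ∑ v, rticks M arr j v ω} ≤ ENNReal.ofReal (n ^ 2 * (1 / M) ^ 2) := by
  have hpair : ∀ u v, P (if u = v then {ω | 2 ≤ rticks M arr j v ω} else
      (rticks M arr j u ⁻¹' {0}ᶜ ∩ rticks M arr j v ⁻¹' {0}ᶜ)) ≤
      ENNReal.ofReal ((1 / M) ^ 2) := by
    intro u v
    split_ifs with huv
    · exact hR.measure_two_le_rticks M j v
    · have hm : Measurable fun x : ℕ → ℝ => cnt x (grid M (j + 1)) - cnt x (grid M j) :=
        (measurable_cnt _).sub (measurable_cnt _)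
      have hind : IndepFun (rticks M arr j u) (rticks M arr j v) P :=
        (hR.clock_indep.indepFun huv).comp hm hm
      rw [hind.measure_inter_preimage_eq_mul _ _ (by measurability) (by measurability), pow_two,
        ENNReal.ofReal_mul (by positivity)]
      exact mul_le_mul' (hR.measure_rticks_ne_zero M j u) (hR.measure_rticks_ne_zero M j v)
  have hsub : {ω | 2 ≤ ∑ v, rticks M arr j v ω} ⊆ ⋃ p ∈ (Finset.univ : Finset (Fin n × Fin n)),
      (if p.1 = p.2 then {ω | 2 ≤ rticks M arr j p.2 ω} else
        (rticks M arr j p.1 ⁻¹' {0}ᶜ ∩ rticks M arr j p.2 ⁻¹' {0}ᶜ)) := by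
    intro ω hω
    simp only [Set.mem_iUnion, Finset.mem_univ, exists_true_left, Prod.exists]
    simp only [Set.mem_ofPred_eq] at hω
    obtain ⟨u, -, hu⟩ : ∃ u ∈ Finset.univ, rticks M arr j u ω ≠ 0 := by
      by_contra! h
      rw [Finset.sum_eq_zero h] at hω
      omega
    by_cases h2 : 2 ≤ rticks M arr j u ω
    · exact ⟨u, u, by simpa using h2⟩
    · obtain ⟨v, hv, hv'⟩ : ∃ v ∈ Finset.univ.erase u, rticks M arr j v ω ≠ 0 := by
        by_contra! h
        rw [← Finset.add_sum_erase _ _ (Finset.mem_univ u), Finset.sum_eq_zero h] at hω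
        omega
      refine ⟨u, v, ?_⟩
      rw [if_neg (Finset.ne_of_mem_erase hv).symm]
      exact ⟨hu, hv'⟩
  refine (measure_mono hsub).trans ((measure_biUnion_finset_le _ _).trans ?_)
  refine (Finset.sum_le_sum fun p _ => hpair p.1 p.2).trans ?_
  rw [Finset.sum_const, nsmul_eq_mul, ENNReal.ofReal_mul (by positivity)]
  refine le_of_eq ?_
  congr 1
  rw [Finset.card_univ, Fintype.card_prod, Fintype.card_fin]
  rw [ENNReal.ofReal_pow (by positivity), ENNReal.ofReal_natCast]
  push_cast
  ring

/-- Independence of the clocks separates the nodes, and independent increments separate the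
intervals of one clock. -/
theorem IsAsyncRandomness.measure_iInter_rticks [MeasurableSpace Ω] {P : Measure Ω}
    (hR : IsAsyncRandomness P arr ch) (M m : ℕ)
    (B : ℕ → Fin n → Set ℕ) :
    P (⋂ v, ⋂ i ∈ Finset.range m, rticks M arr i v ⁻¹' B i v) =
      ∏ v, ∏ i ∈ Finset.range m, P (rticks M arr i v ⁻¹' B i v) := by
  have hm : ∀ i, Measurable fun x : ℕ → ℝ => cnt x (grid M (i + 1)) - cnt x (grid M i) :=
    fun i => (measurable_cnt _).sub (measurable_cnt _)
  rw [hR.clock_indep.meas_iInter]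
  · refine Finset.prod_congr rfl fun v _ => ?_
    exact ((hR.clock v).indep.nat (grid_mono M)).measure_inter_preimage_eq_mul
      (Finset.range m) (sets := fun i => B i v) fun i _ => by measurability
  · intro v
    refine ⟨⋂ i ∈ Finset.range m,
      (fun x : ℕ → ℝ => cnt x (grid M (i + 1)) - cnt x (grid M i)) ⁻¹' B i v, ?_, ?_⟩
    · exact Finset.measurableSet_biInter _ fun i _ => hm i (by measurability)
    · ext ω
      simp only [Set.mem_preimage, Set.mem_iInter]
      rfl

/-! ## Independence of the past of the simulation and the next call -/

/-- The pattern of ticks in the first `j` grid intervals that is given by `a`. -/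
def extendPattern {j : ℕ} (a : Fin n → Fin j → ℕ) (i : ℕ) (v : Fin n) : ℕ :=
  if h : i < j then a v ⟨i, h⟩ else 0

/-- The event that the ticks in the first `j` grid intervals have the pattern `a`. -/
def patternEvent (M : ℕ) (arr : Fin n → ℕ → Ω → ℝ) {j : ℕ} (a : Fin n → Fin j → ℕ) : Set Ω :=
  ⋂ v, ⋂ i ∈ Finset.range j, rticks M arr i v ⁻¹' {extendPattern a i v}

theorem mem_patternEvent {M j : ℕ} {a : Fin n → Fin j → ℕ} {ω : Ω} :
    ω ∈ patternEvent M arr a ↔ ∀ i < j, ∀ v, rticks M arr i v ω = extendPattern a i v := by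
  simp only [patternEvent, Set.mem_iInter, Finset.mem_range, Set.mem_preimage,
    Set.mem_singleton_iff]
  exact ⟨fun h i hi v => h v i hi, fun h v i hi => h i hi v⟩

theorem iUnion_patternEvent (M j : ℕ) :
    ⋃ a : Fin n → Fin j → ℕ, patternEvent M arr a = Set.univ := by
  refine Set.eq_univ_of_forall fun ω => Set.mem_iUnion.2
    ⟨fun v i => rticks M arr i v ω, mem_patternEvent.2 fun i hi v => ?_⟩
  simp [extendPattern, hi]

theorem disjoint_patternEvent (M j : ℕ) :
    Pairwise (Function.onFun Disjoint
      fun a : Fin n → Fin j → ℕ => patternEvent M arr a) := by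
  intro a b hab
  rw [Function.onFun, Set.disjoint_left]
  intro ω ha hb
  refine hab (funext fun v => funext fun i => ?_)
  have h1 := mem_patternEvent.1 ha i i.2 v
  have h2 := mem_patternEvent.1 hb i i.2 v
  simpa [extendPattern] using h1.symm.trans h2

theorem IsAsyncRandomness.measurableSet_patternEvent [MeasurableSpace Ω] {P : Measure Ω}
    (hR : IsAsyncRandomness P arr ch) (M : ℕ)
    {j : ℕ} (a : Fin n → Fin j → ℕ) : MeasurableSet (patternEvent M arr a) :=
  MeasurableSet.iInter fun v => Finset.measurableSet_biInter _ fun i _ =>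
    hR.measurable_rticks M i v (by measurability)

theorem IsAsyncRandomness.measure_patternEvent_inter [MeasurableSpace Ω] {P : Measure Ω}
    (hR : IsAsyncRandomness P arr ch) (M : ℕ)
    {j : ℕ} (a : Fin n → Fin j → ℕ) (u : Fin n) :
    P (patternEvent M arr a ∩ rticks M arr j u ⁻¹' {0}ᶜ) =
      P (patternEvent M arr a) * P (rticks M arr j u ⁻¹' {0}ᶜ) := by
  -- The intersection is written as one product event over `j + 1` intervals, with no condition in
  -- the last interval on nodes other than `u`.
  set B : ℕ → Fin n → Set ℕ := fun i v =>
    if i < j then {extendPattern a i v} else if v = u then {0}ᶜ else Set.univ with hB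
  have h1 : patternEvent M arr a ∩ rticks M arr j u ⁻¹' {0}ᶜ =
      ⋂ v, ⋂ i ∈ Finset.range (j + 1), rticks M arr i v ⁻¹' B i v := by
    ext ω
    simp only [Set.mem_inter_iff, mem_patternEvent, Set.mem_iInter, Finset.mem_range, hB]
    constructor
    · rintro ⟨h1, h2⟩ v i hi
      rcases Nat.lt_succ_iff_lt_or_eq.1 hi with h | rfl
      · simpa [h] using h1 i h v
      · by_cases hv : v = u
        · subst hv; simpa using h2
        · simp [hv]
    · intro h
      constructor
      · intro i hi v
        simpa [hi] using h v i (by omega)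
      · simpa using h u j (by omega)
  rw [h1, hR.measure_iInter_rticks, patternEvent, hR.measure_iInter_rticks]
  simp only [Finset.prod_range_succ, Finset.prod_mul_distrib]
  congr 1
  · refine Finset.prod_congr rfl fun v _ => Finset.prod_congr rfl fun i hi => ?_
    simp only [hB]
    rw [if_pos (Finset.mem_range.1 hi)]
  · simp only [hB, lt_irrefl, if_false]
    rw [Finset.prod_eq_single u]
    · simp
    · intro v _ hv
      have := hR.choice_indep.isProbabilityMeasure
      simp [hv]
    · simp

/-- The state of the simulation as a random variable. -/
def rrun (net : DynamicNetwork n) (v₀ : Fin n) (M : ℕ) (arr : Fin n → ℕ → Ω → ℝ)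
    (ch : Fin n → ℕ → Ω → Finset (Fin n) → Fin n) (j : ℕ) (ω : Ω) :
    Finset (Fin n) × List (Finset (Fin n)) :=
  run net v₀ M (ticks M fun v k => arr v k ω) (fun v k => ch v k ω) j

theorem rrun_eq {net : DynamicNetwork n} {v₀ : Fin n} {M j : ℕ} {a : Fin n → Fin j → ℕ} {ω : Ω}
    (h : ω ∈ patternEvent M arr a) :
    rrun net v₀ M arr ch j ω = run net v₀ M (extendPattern a) (fun v k => ch v k ω) j :=
  run_congr net v₀ M j (fun i hi => funext fun v => mem_patternEvent.1 h i hi v) fun _ _ _ => rfl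

/-- The indices of the choices that are used under a given tick pattern. -/
def usedChoices {j : ℕ} (a : Fin n → Fin j → ℕ) : Finset (Fin n × ℕ) :=
  (Finset.univ ×ˢ Finset.range (∑ v, ∑ i ∈ Finset.range j, extendPattern a i v)).filter
    fun p => p.2 < ∑ i ∈ Finset.range j, extendPattern a i p.1

theorem mem_usedChoices {j : ℕ} {a : Fin n → Fin j → ℕ} {v : Fin n} {k : ℕ} :
    (v, k) ∈ usedChoices a ↔ k < ∑ i ∈ Finset.range j, extendPattern a i v := by
  simp only [usedChoices, Finset.mem_filter, Finset.mem_product, Finset.mem_univ, true_and,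
    Finset.mem_range, and_iff_right_iff_imp]
  intro h
  exact h.trans_le (Finset.single_le_sum
    (f := fun v => ∑ i ∈ Finset.range j, extendPattern a i v) (fun _ _ => Nat.zero_le _)
    (Finset.mem_univ v))

/-- Choices that agree with `y` on the used indices. -/
def extendChoices {j : ℕ} {a : Fin n → Fin j → ℕ}
    (y : usedChoices a → Finset (Fin n) → Fin n) (v : Fin n) (k : ℕ) : Finset (Fin n) → Fin n :=
  if h : (v, k) ∈ usedChoices a then y ⟨_, h⟩ else fun _ => v

theorem run_extendChoices (net : DynamicNetwork n) (v₀ : Fin n) (M : ℕ) {j : ℕ}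
    (a : Fin n → Fin j → ℕ) (c : Fin n → ℕ → Finset (Fin n) → Fin n) :
    run net v₀ M (extendPattern a) c j =
      run net v₀ M (extendPattern a) (extendChoices (a := a) fun i => c i.1.1 i.1.2) j :=
  run_congr net v₀ M j (fun _ _ => rfl) fun v k hk => by
    rw [extendChoices, dif_pos (mem_usedChoices.2 hk)]

/-- For a fixed pattern the run factors through finitely many choices, which take values in a finite
discrete space. -/
theorem measurableSet_run_eq (net : DynamicNetwork n) (v₀ : Fin n) (M : ℕ) {j : ℕ}
    (a : Fin n → Fin j → ℕ) (s : Finset (Fin n) × List (Finset (Fin n))) :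
    MeasurableSet {c : Fin n → ℕ → Finset (Fin n) → Fin n |
      run net v₀ M (extendPattern a) c j = s} := by
  have h : Measurable fun (c : Fin n → ℕ → Finset (Fin n) → Fin n) (i : usedChoices a) =>
      c i.1.1 i.1.2 := measurable_pi_lambda _ fun i =>
    (measurable_pi_apply i.1.2).comp (measurable_pi_apply i.1.1)
  have := h (MeasurableSet.of_discrete
    (s := {y | run net v₀ M (extendPattern a) (extendChoices y) j = s}))
  simpa only [Set.preimage_ofPred_eq, ← run_extendChoices] using this

theorem IsAsyncRandomness.measurableSet_rrun_eq [MeasurableSpace Ω] {P : Measure Ω}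
    (hR : IsAsyncRandomness P arr ch)
    (net : DynamicNetwork n) (v₀ : Fin n) (M j : ℕ)
    (s : Finset (Fin n) × List (Finset (Fin n))) :
    MeasurableSet {ω | rrun net v₀ M arr ch j ω = s} := by
  have : {ω | rrun net v₀ M arr ch j ω = s} = ⋃ a : Fin n → Fin j → ℕ, patternEvent M arr a ∩
      (fun ω v k => ch v k ω) ⁻¹' {c | run net v₀ M (extendPattern a) c j = s} := by
    ext ω
    simp only [Set.mem_iUnion, Set.mem_inter_iff, Set.mem_ofPred_eq, Set.mem_preimage]
    constructor
    · intro h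
      obtain ⟨a, ha⟩ := Set.mem_iUnion.1 ((iUnion_patternEvent (arr := arr) M j).symm ▸
        Set.mem_univ ω)
      exact ⟨a, ha, by rw [← h, rrun_eq ha]⟩
    · rintro ⟨a, ha, h⟩
      rw [rrun_eq ha, h]
  rw [this]
  exact MeasurableSet.iUnion fun a => (hR.measurableSet_patternEvent M a).inter
    (hR.measurable_ch (measurableSet_run_eq net v₀ M a s))

/-- The states form a countable set and carry no σ-algebra; every function of the state is
measurable because each state is attained on a measurable event. -/
theorem IsAsyncRandomness.measurable_comp_rrun [MeasurableSpace Ω] {P : Measure Ω}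
    (hR : IsAsyncRandomness P arr ch)
    (net : DynamicNetwork n) (v₀ : Fin n) (M j : ℕ) {β : Type*} [MeasurableSpace β]
    (f : Finset (Fin n) × List (Finset (Fin n)) → β) :
    Measurable fun ω => f (rrun net v₀ M arr ch j ω) := by
  intro B _
  have : (fun ω => f (rrun net v₀ M arr ch j ω)) ⁻¹' B =
      ⋃ s ∈ f ⁻¹' B, {ω | rrun net v₀ M arr ch j ω = s} := by
    ext ω
    simp
  rw [this]
  exact MeasurableSet.biUnion (Set.to_countable _) fun s _ => hR.measurableSet_rrun_eq net v₀ M j s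

/-- The event that `u` ticks in the grid interval number `j`, and contacts `w` if `X` is its set of
neighbours. -/
def callEvent (M : ℕ) (arr : Fin n → ℕ → Ω → ℝ) (ch : Fin n → ℕ → Ω → Finset (Fin n) → Fin n)
    (j : ℕ) (u w : Fin n) (X : Finset (Fin n)) : Set Ω :=
  {ω | rticks M arr j u ω ≠ 0 ∧ ch u (∑ i ∈ Finset.range j, rticks M arr i u ω) ω X = w}

theorem IsAsyncRandomness.measurableSet_choice_eq [MeasurableSpace Ω] {P : Measure Ω}
    (hR : IsAsyncRandomness P arr ch) (u : Fin n)
    (k : ℕ) (X : Finset (Fin n)) (w : Fin n) : MeasurableSet {ω | ch u k ω X = w} :=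
  ((measurable_pi_apply X).comp (hR.choice_measurable u k)) (measurableSet_singleton w)

theorem IsAsyncRandomness.measurableSet_callEvent [MeasurableSpace Ω] {P : Measure Ω}
    (hR : IsAsyncRandomness P arr ch) (M j : ℕ)
    (u w : Fin n) (X : Finset (Fin n)) : MeasurableSet (callEvent M arr ch j u w X) := by
  have : callEvent M arr ch j u w X = rticks M arr j u ⁻¹' {0}ᶜ ∩ ⋃ k : ℕ,
      ((fun ω => ∑ i ∈ Finset.range j, rticks M arr i u ω) ⁻¹' {k} ∩ {ω | ch u k ω X = w}) := by
    ext ω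
    simp [callEvent]
  rw [this]
  refine (hR.measurable_rticks M j u (by measurability)).inter (MeasurableSet.iUnion fun k => ?_)
  exact ((Finset.measurable_sum _ fun i _ => hR.measurable_rticks M i u)
    (by measurability)).inter (hR.measurableSet_choice_eq u k X w)

/-- Fixing the tick pattern makes the index `K` of the next choice of `u` deterministic. The event
then splits into a clock part and a choice part, which are independent. The clock part is handled by
independent increments, the choice part by the fact that `(u, K)` has not been used so far. -/
theorem IsAsyncRandomness.measure_pattern_run_call_le [MeasurableSpace Ω] {P : Measure Ω}
    (hR : IsAsyncRandomness P arr ch)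
    (net : DynamicNetwork n) (v₀ : Fin n) (M : ℕ) {j : ℕ} (a : Fin n → Fin j → ℕ)
    (s : Finset (Fin n) × List (Finset (Fin n))) (u : Fin n) {w : Fin n} {X : Finset (Fin n)}
    (hw : w ∈ X) :
    P (patternEvent M arr a ∩ ({ω | rrun net v₀ M arr ch j ω = s} ∩
        callEvent M arr ch j u w X)) ≤
      P (patternEvent M arr a ∩ {ω | rrun net v₀ M arr ch j ω = s}) *
        (ENNReal.ofReal (1 / M) * (X.card : ℝ≥0∞)⁻¹) := by
  set K := ∑ i ∈ Finset.range j, extendPattern a i u with hK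
  set C1 : Set (Fin n → ℕ → Finset (Fin n) → Fin n) :=
    {c | run net v₀ M (extendPattern a) c j = s} with hC1
  set C2 : Set (Fin n → ℕ → Finset (Fin n) → Fin n) := {c | c u K X = w} with hC2
  have hC1m : MeasurableSet C1 := measurableSet_run_eq net v₀ M a s
  have hC2m : MeasurableSet C2 := by
    have : Measurable fun c : Fin n → ℕ → Finset (Fin n) → Fin n => c u K X :=
      (measurable_pi_apply X).comp ((measurable_pi_apply K).comp (measurable_pi_apply u))
    exact this (measurableSet_singleton w)
  set A1 : Set (Fin n → ℕ → ℝ) :=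
    {x | ∀ i < j, ∀ v, ticks M x i v = extendPattern a i v} with hA1
  have hA1m : MeasurableSet A1 := by
    simp only [hA1, Set.ofPred_forall]
    refine MeasurableSet.iInter fun i => MeasurableSet.iInter fun _ => MeasurableSet.iInter
      fun v => measurable_ticks M i v (measurableSet_singleton _)
  have hA1e : patternEvent M arr a = (fun ω v k => arr v k ω) ⁻¹' A1 := by
    ext ω
    rw [mem_patternEvent]
    rfl
  set A2 : Set (Fin n → ℕ → ℝ) := {x | ticks M x j u ∈ ({0}ᶜ : Set ℕ)} with hA2
  have hA2m : MeasurableSet A2 := measurable_ticks M j u (by measurability)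
  have h1 : patternEvent M arr a ∩ ({ω | rrun net v₀ M arr ch j ω = s} ∩
        callEvent M arr ch j u w X) =
      (fun ω v k => arr v k ω) ⁻¹' (A1 ∩ A2) ∩ (fun ω v k => ch v k ω) ⁻¹' (C1 ∩ C2) := by
    ext ω
    by_cases hω : ω ∈ patternEvent M arr a
    · have h2 : ∑ i ∈ Finset.range j, rticks M arr i u ω = K :=
        Finset.sum_congr rfl fun i hi => mem_patternEvent.1 hω i (Finset.mem_range.1 hi) u
      have h3 : (fun v k => arr v k ω) ∈ A1 := by rw [hA1e] at hω; exact hω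
      simp only [Set.mem_inter_iff, hω, true_and, Set.mem_ofPred_eq, rrun_eq hω, callEvent, h2,
        Set.mem_preimage, h3, hA2, hC1, hC2]
      simp only [Set.mem_compl_iff, Set.mem_singleton_iff, rticks]
      tauto
    · have h3 : (fun v k => arr v k ω) ∉ A1 := by rw [hA1e] at hω; exact hω
      simp [hω, h3]
  have h2 : patternEvent M arr a ∩ {ω | rrun net v₀ M arr ch j ω = s} =
      (fun ω v k => arr v k ω) ⁻¹' A1 ∩ (fun ω v k => ch v k ω) ⁻¹' C1 := by
    rw [← hA1e]
    ext ω
    refine and_congr_right fun hω => ?_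
    simp only [Set.mem_ofPred_eq, rrun_eq hω, Set.mem_preimage, hC1]
  have h3 : P ((fun ω v k => arr v k ω) ⁻¹' (A1 ∩ A2)) ≤
      P ((fun ω v k => arr v k ω) ⁻¹' A1) * ENNReal.ofReal (1 / M) := by
    rw [Set.preimage_inter, ← hA1e]
    refine (hR.measure_patternEvent_inter M a u).le.trans ?_
    gcongr
    exact hR.measure_rticks_ne_zero M j u
  have h4 : P ((fun ω v k => ch v k ω) ⁻¹' (C1 ∩ C2)) =
      P ((fun ω v k => ch v k ω) ⁻¹' C1) * (X.card : ℝ≥0∞)⁻¹ := by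
    have hdisj : Disjoint (usedChoices a) {(u, K)} := by
      rw [Finset.disjoint_singleton_right, mem_usedChoices]
      exact lt_irrefl _
    have hind := hR.choice_indep.indepFun_finset _ _ hdisj
      fun p => hR.choice_measurable p.1 p.2
    have h5 := hind.measure_inter_preimage_eq_mul
      {y | run net v₀ M (extendPattern a) (extendChoices y) j = s}
      {y | y ⟨(u, K), Finset.mem_singleton_self _⟩ X = w}
      MeasurableSet.of_discrete MeasurableSet.of_discrete
    have h6 : P {ω | ch u K ω X = w} = (X.card : ℝ≥0∞)⁻¹ := hR.choice_uniform u K X w hw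
    simp only [Set.preimage_ofPred_eq] at h5
    rw [h6] at h5
    have h7 : C1 = {c | run net v₀ M (extendPattern a)
        (extendChoices (a := a) fun i => c i.1.1 i.1.2) j = s} := by
      ext c
      simp only [hC1, Set.mem_ofPred_eq]
      rw [run_extendChoices]
    rw [Set.preimage_inter, h7]
    exact h5
  rw [h1, h2, hR.clock_choice_indep.measure_inter_preimage_eq_mul _ _ (hA1m.inter hA2m)
    (hC1m.inter hC2m), hR.clock_choice_indep.measure_inter_preimage_eq_mul _ _ hA1m hC1m, h4]
  calc _ ≤ P ((fun ω v k => arr v k ω) ⁻¹' A1) * ENNReal.ofReal (1 / M) *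
        (P ((fun ω v k => ch v k ω) ⁻¹' C1) * (X.card : ℝ≥0∞)⁻¹) := by gcongr
    _ = _ := by ring

theorem IsAsyncRandomness.measure_run_call_le [MeasurableSpace Ω] {P : Measure Ω}
    (hR : IsAsyncRandomness P arr ch)
    (net : DynamicNetwork n) (v₀ : Fin n) (M j : ℕ)
    (s : Finset (Fin n) × List (Finset (Fin n))) (u : Fin n) {w : Fin n} {X : Finset (Fin n)}
    (hw : w ∈ X) :
    P ({ω | rrun net v₀ M arr ch j ω = s} ∩ callEvent M arr ch j u w X) ≤
      P {ω | rrun net v₀ M arr ch j ω = s} *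
        (ENNReal.ofReal (1 / M) * (X.card : ℝ≥0∞)⁻¹) := by
  have hdec : ∀ B : Set Ω, MeasurableSet B →
      P B = ∑' a : Fin n → Fin j → ℕ, P (patternEvent M arr a ∩ B) := by
    intro B hB
    rw [← measure_iUnion, ← Set.iUnion_inter, iUnion_patternEvent, Set.univ_inter]
    · exact fun a b hab => ((disjoint_patternEvent M j hab).mono Set.inter_subset_left
        Set.inter_subset_left)
    · exact fun a => (hR.measurableSet_patternEvent M a).inter hB
  have hs := hR.measurableSet_rrun_eq net v₀ M j s
  rw [hdec _ hs, hdec _ (hs.inter (hR.measurableSet_callEvent M j u w X)), ← ENNReal.tsum_mul_right]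
  exact ENNReal.tsum_le_tsum fun a => hR.measure_pattern_run_call_le net v₀ M a s u hw

/-- Conditioning on the state in integrated form. `X` will be the neighbourhood of `u` in the
current graph, which is itself random; the sum over the countably many states freezes it. -/
theorem IsAsyncRandomness.lintegral_call_le [MeasurableSpace Ω] {P : Measure Ω}
    (hR : IsAsyncRandomness P arr ch)
    (net : DynamicNetwork n) (v₀ : Fin n) (M j : ℕ) (u w : Fin n)
    (D : Finset (Fin n) × List (Finset (Fin n)) → ℝ≥0∞)
    (X : Finset (Fin n) × List (Finset (Fin n)) → Finset (Fin n))
    (hX : ∀ s, D s ≠ 0 → w ∈ X s) :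
    ∫⁻ ω, D (rrun net v₀ M arr ch j ω) *
        (callEvent M arr ch j u w (X (rrun net v₀ M arr ch j ω))).indicator 1 ω ∂P ≤
      ∫⁻ ω, D (rrun net v₀ M arr ch j ω) * (ENNReal.ofReal (1 / M) *
        ((X (rrun net v₀ M arr ch j ω)).card : ℝ≥0∞)⁻¹) ∂P := by
  have hdec : ∀ F : Finset (Fin n) × List (Finset (Fin n)) → Ω → ℝ≥0∞, (∀ s, Measurable (F s)) →
      ∫⁻ ω, F (rrun net v₀ M arr ch j ω) ω ∂P =
        ∑' s, ∫⁻ ω in {ω | rrun net v₀ M arr ch j ω = s}, F s ω ∂P := by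
    intro F hF
    have h1 : ∀ s, MeasurableSet {ω | rrun net v₀ M arr ch j ω = s} :=
      fun s => hR.measurableSet_rrun_eq net v₀ M j s
    have h2 : (⋃ s, {ω | rrun net v₀ M arr ch j ω = s}) = Set.univ := by
      ext ω; simp
    rw [← setLIntegral_univ, ← h2, lintegral_iUnion h1]
    · refine tsum_congr fun s => setLIntegral_congr_fun (h1 s) fun ω hω => ?_
      simp only [Set.mem_ofPred_eq] at hω
      simp only [hω]
    · intro s t hst
      rw [Function.onFun, Set.disjoint_left]
      intro ω h3 h4
      exact hst (h3.symm.trans h4)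
  have hm : ∀ s, MeasurableSet (callEvent M arr ch j u w (X s)) :=
    fun s => hR.measurableSet_callEvent M j u w _
  rw [hdec (fun s ω => D s * (callEvent M arr ch j u w (X s)).indicator 1 ω)
      fun s => (measurable_one.indicator (hm s)).const_mul _,
    hdec (fun s _ => D s * (ENNReal.ofReal (1 / M) * ((X s).card : ℝ≥0∞)⁻¹))
      fun s => measurable_const]
  refine ENNReal.tsum_le_tsum fun s => ?_
  rw [lintegral_const_mul _ (measurable_one.indicator (hm s)), lintegral_indicator_one (hm s),
    Measure.restrict_apply (hm s), setLIntegral_const, Set.inter_comm]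
  by_cases hD : D s = 0
  · simp [hD]
  · rw [mul_assoc, mul_comm (ENNReal.ofReal (1 / M) * ((X s).card : ℝ≥0∞)⁻¹)]
    gcongr
    exact hR.measure_run_call_le net v₀ M j s u (hX s hD)

end

/-! ## Almost regular graphs with a bottleneck -/

/-- A connected graph with degrees between `D` and `2 * D` in which at most one edge leaves `A`. -/
structure IsBottleneck (D : ℕ) (A : Finset (Fin n)) (G : SimpleGraph (Fin n)) : Prop where
  connected : G.Connected
  le_degree : ∀ v, D ≤ G.degree v
  degree_le : ∀ v, G.degree v ≤ 2 * D
  bridge : ∃ p q, ∀ x ∈ A, ∀ y ∉ A, G.Adj x y → x = p ∧ y = q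

/-- The `D`-th power of a path on `Fin n`, where of the edges between the first `m` nodes and the
others only `{m - 1, m}` is kept. -/
def splitPathPower (n D m : ℕ) : SimpleGraph (Fin n) where
  Adj i j := i ≠ j ∧ (i : ℕ) ≤ j + D ∧ (j : ℕ) ≤ i + D ∧
    (((i : ℕ) < m ↔ (j : ℕ) < m) ∨ ((i : ℕ) + 1 = m ∧ (j : ℕ) = m) ∨
      ((j : ℕ) + 1 = m ∧ (i : ℕ) = m))
  symm := ⟨fun i j h => ⟨h.1.symm, h.2.2.1, h.2.1, by tauto⟩⟩
  loopless := ⟨fun i h => h.1 rfl⟩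

/-- The edges between consecutive nodes all survive, including `{m - 1, m}`. -/
theorem splitPathPower_connected {n D m : ℕ} (hn : 0 < n) (hD : 0 < D) :
    (splitPathPower n D m).Connected := by
  have key : ∀ k (hk : k < n), (splitPathPower n D m).Reachable ⟨0, hn⟩ ⟨k, hk⟩ := by
    intro k
    induction k with
    | zero => exact fun _ => SimpleGraph.Reachable.refl _
    | succ k ih =>
      intro hk
      refine (ih (by omega)).trans (SimpleGraph.Adj.reachable ?_)
      refine ⟨by simp, ?_, ?_, ?_⟩ <;> simp only <;> omega
  have : Nonempty (Fin n) := ⟨⟨0, hn⟩⟩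
  exact ⟨fun u v => (key u u.2).symm.trans (key v v.2)⟩

theorem splitPathPower_degree_le (n D m : ℕ) (i : Fin n) :
    (splitPathPower n D m).degree i ≤ 2 * D := by
  rw [← SimpleGraph.card_neighborFinset_eq_degree, ← Finset.card_map Fin.valEmbedding]
  have h : ((splitPathPower n D m).neighborFinset i).map Fin.valEmbedding ⊆
      (Finset.Icc ((i : ℕ) - D) (i + D)).erase i := by
    intro k hk
    obtain ⟨j, hj, rfl⟩ := Finset.mem_map.1 hk
    rw [SimpleGraph.mem_neighborFinset] at hj
    have h1 := hj.1
    have h2 := hj.2.1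
    have h3 := hj.2.2.1
    have h4 : (i : ℕ) ≠ j := fun h => h1 (Fin.ext h)
    simp only [Fin.valEmbedding_apply, Finset.mem_erase, Finset.mem_Icc]
    omega
  refine (Finset.card_le_card h).trans ?_
  rw [Finset.card_erase_of_mem (by simp), Nat.card_Icc]
  omega

/-- Each side of the cut is empty or has at least `D + 1` nodes, so `i` lies in a window of `D + 1`
consecutive nodes on its own side. The other `D` nodes of the window are its neighbours. -/
theorem le_splitPathPower_degree {n D m : ℕ} (hm : m = 0 ∨ D + 1 ≤ m) (hmn : m + (D + 1) ≤ n)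
    (i : Fin n) : D ≤ (splitPathPower n D m).degree i := by
  rw [← SimpleGraph.card_neighborFinset_eq_degree, ← Finset.card_map Fin.valEmbedding]
  have hi := i.2
  obtain ⟨s, h1, h2, h3, h4⟩ : ∃ s, s ≤ (i : ℕ) ∧ (i : ℕ) ≤ s + D ∧ s + D < n ∧
      ((i : ℕ) < m ∧ s + D < m ∨ m ≤ (i : ℕ) ∧ m ≤ s) := by
    by_cases him : (i : ℕ) < m
    · by_cases h : (i : ℕ) + D < m
      · exact ⟨i, by omega⟩
      · exact ⟨m - 1 - D, by omega⟩
    · by_cases h : (i : ℕ) + D < n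
      · exact ⟨i, by omega⟩
      · exact ⟨n - 1 - D, by omega⟩
  have h : (Finset.Icc s (s + D)).erase i ⊆
      ((splitPathPower n D m).neighborFinset i).map Fin.valEmbedding := by
    intro k hk
    simp only [Finset.mem_erase, Finset.mem_Icc] at hk
    refine Finset.mem_map.2 ⟨⟨k, by omega⟩, ?_, rfl⟩
    rw [SimpleGraph.mem_neighborFinset]
    refine ⟨fun h => hk.1 (by rw [h]), ?_, ?_, ?_⟩ <;> simp only <;> omega
  refine le_trans ?_ (Finset.card_le_card h)
  rw [Finset.card_erase_of_mem (by simp; omega), Nat.card_Icc]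
  omega

theorem exists_equiv_lt_card (A : Finset (Fin n)) :
    ∃ e : Fin n ≃ Fin n, ∀ v, v ∈ A ↔ (e v : ℕ) < A.card := by
  have hA : A.card ≤ n := by simpa using Finset.card_le_univ A
  have hcard : Fintype.card {v // v ∈ A} = Fintype.card {i : Fin n // (i : ℕ) < A.card} := by
    rw [Fintype.card_coe, Fintype.card_subtype]
    rcases Nat.lt_or_ge A.card n with h | h
    · rw [show (Finset.univ.filter fun i : Fin n => (i : ℕ) < A.card) =
        Finset.Iio ⟨A.card, h⟩ by ext i; simp [Fin.lt_def]]
      simp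
    · have h' : A.card = n := le_antisymm hA h
      rw [h', Finset.filter_true_of_mem (fun i _ => i.2)]
      simp
  have e := Fintype.equivOfCardEq hcard
  refine ⟨e.extendSubtype, fun v => ⟨fun h => e.extendSubtype_mem v h, fun h => ?_⟩⟩
  by_contra hv
  exact e.extendSubtype_not_mem v hv h

theorem exists_isBottleneck {D : ℕ} (hD : 0 < D) (A : Finset (Fin n))
    (hA : A = ∅ ∨ D + 1 ≤ A.card) (hAn : A.card + (D + 1) ≤ n) :
    ∃ G : SimpleGraph (Fin n), IsBottleneck D A G := by
  obtain ⟨e, he⟩ := exists_equiv_lt_card A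
  set m := A.card with hm
  let φ : (splitPathPower n D m).comap e ≃g splitPathPower n D m :=
    SimpleGraph.Iso.comap e (splitPathPower n D m)
  have hdeg : ∀ v, ((splitPathPower n D m).comap e).degree v =
      (splitPathPower n D m).degree (e v) := fun v => (φ.degree_eq v).symm
  have hm' : m = 0 ∨ D + 1 ≤ m := hA.imp (fun h => by rw [hm, h, Finset.card_empty]) id
  refine ⟨(splitPathPower n D m).comap e,
    φ.connected_iff.2 (splitPathPower_connected (by omega) hD),
    fun v => hdeg v ▸ le_splitPathPower_degree hm' hAn _,
    fun v => hdeg v ▸ splitPathPower_degree_le n D m _,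
    -- For `A = ∅` the truncated `m - 1` is `0`; the bridge condition is then vacuous.
    e.symm ⟨m - 1, by omega⟩, e.symm ⟨m, by omega⟩, fun x hx y hy hxy => ?_⟩
  have hx' := (he x).1 hx
  have hy' := mt (he y).2 hy
  have h4 := (SimpleGraph.comap_adj.1 hxy).2.2.2
  rw [Equiv.eq_symm_apply, Equiv.eq_symm_apply, Fin.ext_iff, Fin.ext_iff]
  simp only
  omega

/-! ### Diligence and crossing rates of bottleneck graphs -/

section
variable {D : ℕ} {A S : Finset (Fin n)} {G : SimpleGraph (Fin n)}

theorem IsBottleneck.le_absDiligence (h : IsBottleneck D A G) (hD : 0 < D) (hn : 1 < n) :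
    1 / (2 * D : ℝ) ≤ absDiligence G := by
  have : Nontrivial (Fin n) := Fin.nontrivial_iff_two_le.2 hn
  obtain ⟨w, hw⟩ := h.connected.preconnected.exists_adj_of_nontrivial ⟨0, by omega⟩
  have : Nonempty {p : Fin n × Fin n // G.Adj p.1 p.2} := ⟨⟨(_, w), hw⟩⟩
  refine le_ciInf fun e => le_max_of_le_left ?_
  have h1 : (0 : ℝ) < G.degree e.1.1 := by exact_mod_cast hD.trans_le (h.le_degree _)
  have h2 : (G.degree e.1.1 : ℝ) ≤ 2 * D := by exact_mod_cast h.degree_le _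
  exact one_div_le_one_div_of_le h1 h2

theorem IsBottleneck.absDiligence_le (h : IsBottleneck D A G) (hD : 0 < D) (hn : 1 < n) :
    absDiligence G ≤ 1 / (D : ℝ) := by
  have : Nontrivial (Fin n) := Fin.nontrivial_iff_two_le.2 hn
  obtain ⟨w, hw⟩ := h.connected.preconnected.exists_adj_of_nontrivial ⟨0, by omega⟩
  have hD' : (0 : ℝ) < D := by exact_mod_cast hD
  have h1 : ∀ v, 1 / (G.degree v : ℝ) ≤ 1 / D := fun v =>
    one_div_le_one_div_of_le hD' (by exact_mod_cast h.le_degree v)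
  exact (ciInf_le (Set.finite_range _).bddBelow ⟨(_, w), hw⟩).trans (max_le (h1 _) (h1 _))

/-- A call of `u` to `w` informs a node outside `A` if the nodes of `S` are informed. -/
def Crosses (G : SimpleGraph (Fin n)) (A S : Finset (Fin n)) (u w : Fin n) : Prop :=
  G.Adj u w ∧ ((u ∈ S ∧ w ∉ S ∧ w ∉ A) ∨ (w ∈ S ∧ u ∉ S ∧ u ∉ A))

theorem sum_ite_adj (G : SimpleGraph (Fin n)) (u : Fin n) (c : ℝ) :
    ∑ w, (if G.Adj u w then c else 0) = G.degree u * c := by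
  rw [← Finset.sum_filter, Finset.sum_const, ← SimpleGraph.neighborFinset_eq_filter,
    SimpleGraph.card_neighborFinset_eq_degree, nsmul_eq_mul]

/-- The total rate of the calls that inform a node outside `A`. -/
theorem IsBottleneck.sum_crosses_le (h : IsBottleneck D A G) (hD : 0 < D)
    (S : Finset (Fin n)) :
    ∑ u, ∑ w, (if Crosses G A S u w then 1 / (G.degree u : ℝ) else 0) ≤
      3 * (S \ A).card + 2 / D := by
  obtain ⟨p, q, hpq⟩ := h.bridge
  have hD' : (0 : ℝ) < D := by exact_mod_cast hD
  have hdeg : ∀ v, (0 : ℝ) < G.degree v := fun v => by exact_mod_cast hD.trans_le (h.le_degree v)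
  have hinv : ∀ v, 1 / (G.degree v : ℝ) ≤ 1 / D := fun v =>
    one_div_le_one_div_of_le hD' (by exact_mod_cast h.le_degree v)
  have hpos : ∀ v, 0 ≤ 1 / (G.degree v : ℝ) := fun v => (one_div_pos.2 (hdeg v)).le
  have hDpos : (0 : ℝ) ≤ 1 / D := by positivity
  -- Every crossing call is of one of these kinds: a push by a node of `S \ A` (`f1`, rate `1` per
  -- node), a pull from such a node (`f3`, at most `2D` neighbours of rate at most `1/D`), or a push
  -- or pull along the bridge (`f2` in either order of arguments).
  set f1 : Fin n → Fin n → ℝ := fun u w =>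
    if u ∈ S \ A then (if G.Adj u w then 1 / (G.degree u : ℝ) else 0) else 0 with hf1
  set f2 : Fin n → Fin n → ℝ := fun u w => if u = p then (if w = q then 1 / D else 0) else 0
    with hf2
  set f3 : Fin n → Fin n → ℝ := fun w u =>
    if w ∈ S \ A then (if G.Adj w u then 1 / (D : ℝ) else 0) else 0 with hf3
  have h1 : ∑ u, ∑ w, f1 u w ≤ (S \ A).card := by
    have : ∀ u, ∑ w, f1 u w = if u ∈ S \ A then (1 : ℝ) else 0 := fun u => by
      simp only [hf1]
      split_ifs with hu
      · rw [sum_ite_adj, mul_one_div_cancel (hdeg u).ne']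
      · simp
    rw [Finset.sum_congr rfl fun u _ => this u, Finset.sum_ite_mem]
    simp
  have h3 : ∑ w, ∑ u, f3 w u ≤ 2 * (S \ A).card := by
    have : ∀ w, ∑ u, f3 w u ≤ if w ∈ S \ A then (2 : ℝ) else 0 := fun w => by
      simp only [hf3]
      split_ifs with hu
      · rw [sum_ite_adj, mul_one_div, div_le_iff₀ hD']
        exact_mod_cast h.degree_le w
      · simp
    refine (Finset.sum_le_sum fun w _ => this w).trans ?_
    rw [Finset.sum_ite_mem]
    simp [mul_comm]
  have h2 : ∑ u, ∑ w, f2 u w = 1 / D := by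
    simp only [hf2]
    rw [Finset.sum_eq_single p (fun u _ hu => by simp [hu]) (by simp)]
    simp
  have hle : ∀ u w, (if Crosses G A S u w then 1 / (G.degree u : ℝ) else 0) ≤
      f1 u w + f2 u w + f3 w u + f2 w u := by
    intro u w
    have g1 : 0 ≤ f1 u w := by simp only [hf1]; split_ifs <;> first | exact hpos u | exact le_rfl
    have g3 : 0 ≤ f3 w u := by simp only [hf3]; split_ifs <;> first | exact hDpos | exact le_rfl
    have g2 : ∀ u w, 0 ≤ f2 u w := fun u w => by
      simp only [hf2]; split_ifs <;> first | exact hDpos | exact le_rfl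
    have g2' := g2 w u
    have g2 := g2 u w
    split_ifs with hc
    · obtain ⟨hG, ⟨hu, -, hwA⟩ | ⟨hw, -, huA⟩⟩ := hc
      · by_cases huA : u ∈ A
        · obtain ⟨rfl, rfl⟩ := hpq u huA w hwA hG
          have : f2 u w = 1 / D := by simp [hf2]
          linarith [hinv u]
        · have : f1 u w = 1 / (G.degree u : ℝ) := by simp [hf1, hu, huA, hG]
          linarith
      · by_cases hwA : w ∈ A
        · obtain ⟨rfl, rfl⟩ := hpq w hwA u huA hG.symm
          have : f2 w u = 1 / D := by simp [hf2]
          linarith [hinv u]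
        · have : f3 w u = 1 / (D : ℝ) := by simp [hf3, hw, hwA, hG.symm]
          linarith [hinv u]
    · positivity
  calc _ ≤ ∑ u, ∑ w, (f1 u w + f2 u w + f3 w u + f2 w u) :=
        Finset.sum_le_sum fun u _ => Finset.sum_le_sum fun w _ => hle u w
    _ = ∑ u, ∑ w, f1 u w + ∑ u, ∑ w, f2 u w + ∑ w, ∑ u, f3 w u + ∑ w, ∑ u, f2 w u := by
        simp only [Finset.sum_add_distrib]
        rw [Finset.sum_comm (f := fun u w => f3 w u), Finset.sum_comm (f := fun u w => f2 w u)]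
    _ ≤ (S \ A).card + 1 / D + 2 * (S \ A).card + 1 / D := by
        rw [h2]; linarith
    _ = _ := by ring

/-- In a single step at most one node outside `A` is informed, and only by a crossing call. -/
theorem card_step_sdiff_le (N : Fin n → ℕ) (c : Fin n → Finset (Fin n) → Fin n) :
    (step G S N c \ A) = S \ A ∨ (((step G S N c) \ A).card = (S \ A).card + 1 ∧
      ∃ u w, Crosses G A S u w ∧ N u ≠ 0 ∧ c u (G.neighborFinset u) = w) := by
  by_cases hN : ∑ v, N v = 1
  swap
  · left; rw [step, if_neg hN]
  have huniq : ∀ u u', N u ≠ 0 → N u' ≠ 0 → u = u' := by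
    intro u u' hu hu'
    by_contra h
    have := Finset.add_le_sum (f := N) (fun _ _ => Nat.zero_le _) (Finset.mem_univ u)
      (Finset.mem_univ u') h
    omega
  have hmem : ∀ v, v ∈ step G S N c ↔ v ∈ S ∨ ∃ x ∈ S, G.Adj x v ∧
      ((N x ≠ 0 ∧ c x (G.neighborFinset x) = v) ∨ (N v ≠ 0 ∧ c v (G.neighborFinset v) = x)) := by
    intro v
    rw [step, if_pos hN]
    simp
  by_cases hex : ∃ v ∈ step G S N c, v ∉ S ∧ v ∉ A
  · right
    obtain ⟨v, hv, hvS, hvA⟩ := hex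
    obtain ⟨x, hxS, hG, hc⟩ := ((hmem v).1 hv).resolve_left hvS
    constructor
    · have : step G S N c \ A = insert v (S \ A) := by
        ext y
        simp only [Finset.mem_sdiff, Finset.mem_insert]
        constructor
        · rintro ⟨hy, hyA⟩
          by_cases hyS : y ∈ S
          · exact Or.inr ⟨hyS, hyA⟩
          left
          obtain ⟨z, hzS, hG', hc'⟩ := ((hmem y).1 hy).resolve_left hyS
          rcases hc with ⟨h1, h2⟩ | ⟨h1, h2⟩ <;> rcases hc' with ⟨h3, h4⟩ | ⟨h3, h4⟩
          · have := huniq _ _ h1 h3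
            subst this
            exact h4.symm.trans h2
          · have := huniq _ _ h1 h3
            subst this
            exact absurd hxS hyS
          · have := huniq _ _ h1 h3
            subst this
            exact absurd hzS hvS
          · exact (huniq _ _ h1 h3).symm
        · rintro (rfl | ⟨hy, hyA⟩)
          · exact ⟨hv, hvA⟩
          · exact ⟨(hmem y).2 (Or.inl hy), hyA⟩
      rw [this, Finset.card_insert_of_notMem (by simp [hvS])]
    · rcases hc with ⟨h1, h2⟩ | ⟨h1, h2⟩
      · exact ⟨x, v, ⟨hG, Or.inl ⟨hxS, hvS, hvA⟩⟩, h1, h2⟩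
      · exact ⟨v, x, ⟨hG.symm, Or.inr ⟨hxS, hvS, hvA⟩⟩, h1, h2⟩
  · left
    push Not at hex
    ext y
    simp only [Finset.mem_sdiff]
    refine and_congr_left fun hyA => ⟨fun hy => ?_, fun hy => (hmem y).2 (Or.inl hy)⟩
    by_contra hyS
    exact hyA (hex y hy hyS)

end

/-! ## The network -/

/-- A superset of `X` with at least `D + 1` elements, if there is one. -/
def fill (D : ℕ) (X : Finset (Fin n)) : Finset (Fin n) :=
  if h : ∃ Y, X ⊆ Y ∧ Y.card = max X.card (D + 1) then h.choose else X

theorem subset_fill (D : ℕ) (X : Finset (Fin n)) : X ⊆ fill D X := by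
  unfold fill
  split_ifs with h
  · exact h.choose_spec.1
  · exact subset_rfl

theorem card_fill {D : ℕ} (hD : D + 1 ≤ n) (X : Finset (Fin n)) :
    (fill D X).card = max X.card (D + 1) := by
  have hX : X.card ≤ n := by simpa using Finset.card_le_univ X
  have h : ∃ Y, X ⊆ Y ∧ Y.card = max X.card (D + 1) :=
    Finset.exists_superset_card_eq (le_max_left _ _) (by simpa using ⟨hX, hD⟩)
  unfold fill
  rw [dif_pos h]
  exact h.choose_spec.2

/-- The set that contains all nodes known to be informed, enlarged to at least `D + 1` nodes. -/
def barrier (D : ℕ) : List (Finset (Fin n)) → Finset (Fin n)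
  | [] => ∅
  | I :: h => fill D (barrier D h ∪ I)

/-- The network that keeps a bottleneck around the informed nodes as long as this is possible. -/
def bottleneckNetwork (n D : ℕ) : DynamicNetwork n := fun h =>
  if hh : ∃ G, IsBottleneck D (barrier D h) G then hh.choose
  -- When the barrier leaves no room for a bottleneck, the degrees and connectivity are still kept,
  -- since they are required for every history. The final `⊥` does not occur when `0 < D` and `D + 1
  -- ≤ n`.
  else if hh : ∃ G : SimpleGraph (Fin n), IsBottleneck D ∅ G then hh.choose else ⊥

theorem isBottleneck_network {D : ℕ} (hD : 0 < D) (hDn : D + 1 ≤ n)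
    (h : List (Finset (Fin n))) (hc : (barrier D h).card + (D + 1) ≤ n) :
    IsBottleneck D (barrier D h) (bottleneckNetwork n D h) := by
  have hh : ∃ G, IsBottleneck D (barrier D h) G := by
    refine exists_isBottleneck hD _ ?_ hc
    cases h with
    | nil => exact Or.inl rfl
    | cons I h => exact Or.inr (by rw [barrier, card_fill hDn]; exact le_max_right _ _)
  unfold bottleneckNetwork
  rw [dif_pos hh]
  exact hh.choose_spec

theorem exists_isBottleneck_network {D : ℕ} (hD : 0 < D) (hDn : D + 1 ≤ n)
    (h : List (Finset (Fin n))) : ∃ A, IsBottleneck D A (bottleneckNetwork n D h) := by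
  unfold bottleneckNetwork
  split_ifs with h1 h2
  · exact ⟨_, h1.choose_spec⟩
  · exact ⟨_, h2.choose_spec⟩
  · exact absurd (exists_isBottleneck hD ∅ (Or.inl rfl) (by simpa using hDn)) h2

/-! ## The potential -/

/-- The base of the potential of a node outside the barrier, `i` grid intervals after the start of
the current unit of time. -/
def base (ε : ℝ) (M i : ℕ) : ℝ := 1 + ε * (1 + 12 / M) ^ (M - i)

/-- The potential of `Y` informed nodes outside the barrier. -/
def weight (ε : ℝ) (M D i Y : ℕ) : ℝ :=
  -- With nobody outside, the excess over `1` is a budget for a bridge crossing in the remaining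
  -- part of the unit. It is used up linearly.
  if Y = 0 then 1 + (M - i : ℕ) / M * (4 / D) else base ε M i ^ Y

/-- A bound on the increase of the potential when one more node outside the barrier is informed. -/
def increment (ε : ℝ) (M i Y : ℕ) : ℝ :=
  if Y = 0 then 1 else base ε M i ^ Y * (base ε M i - 1)

/-- A value of `ε` for which the bases stay below `2`. -/
def eps : ℝ := Real.exp (-12)

theorem eps_pos : 0 < eps := Real.exp_pos _

theorem one_le_base (M i : ℕ) : 1 ≤ base eps M i := by
  have := eps_pos
  unfold base
  have : 0 ≤ eps * (1 + 12 / (M : ℝ)) ^ (M - i) := by positivity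
  linarith

/-- The growth factor is at most `exp 12`, the inverse of `eps`. -/
theorem base_le_two (M i : ℕ) : base eps M i ≤ 2 := by
  have h1 : (1 + 12 / (M : ℝ)) ^ (M - i) ≤ Real.exp 12 := by
    calc (1 + 12 / (M : ℝ)) ^ (M - i) ≤ (1 + 12 / (M : ℝ)) ^ M :=
          pow_le_pow_right₀ (by have : (0 : ℝ) ≤ 12 / M := by positivity
                                linarith) (Nat.sub_le _ _)
      _ ≤ Real.exp (12 / M) ^ M := by
          gcongr
          rw [add_comm]
          exact Real.add_one_le_exp _
      _ = Real.exp (M * (12 / M)) := (Real.exp_nat_mul _ _).symm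
      _ ≤ Real.exp 12 := by
          refine Real.exp_le_exp.2 ?_
          rcases Nat.eq_zero_or_pos M with rfl | hM
          · simp
          · have : (M : ℝ) ≠ 0 := by positivity
            rw [mul_div_cancel₀ _ this]
  have h2 : eps * Real.exp 12 = 1 := by
    rw [eps, ← Real.exp_add]; simp
  have := mul_le_mul_of_nonneg_left h1 eps_pos.le
  unfold base
  linarith

theorem base_succ {M i : ℕ} (hi : i < M) :
    base eps M i - 1 = (base eps M (i + 1) - 1) * (1 + 12 / M) := by
  unfold base
  rw [show M - i = (M - (i + 1)) + 1 by omega, pow_succ]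
  ring

theorem base_last (M : ℕ) : base eps M M = 1 + eps := by simp [base]

theorem one_le_weight (M D i Y : ℕ) : 1 ≤ weight eps M D i Y := by
  unfold weight
  split_ifs
  · have : (0 : ℝ) ≤ (M - i : ℕ) / M * (4 / D) := by positivity
    linarith
  · exact one_le_pow₀ (one_le_base M i)

theorem increment_nonneg (M i Y : ℕ) : 0 ≤ increment eps M i Y := by
  unfold increment
  have := one_le_base M i
  split_ifs
  · exact zero_le_one
  · exact mul_nonneg (by positivity) (by linarith)

theorem weight_succ_le (M D i Y : ℕ) :
    weight eps M D i (Y + 1) ≤ weight eps M D i Y + increment eps M i Y := by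
  have h2 := base_le_two M i
  by_cases hY : Y = 0
  · subst hY
    have := one_le_weight M D i 0
    simp only [increment, if_true]
    simp only [weight, zero_add, one_ne_zero, if_false, pow_one] at *
    linarith
  · simp only [weight, increment, hY, if_false, Nat.succ_ne_zero]
    rw [pow_succ]
    linarith

/-- The supermartingale inequality for one interval, `R` being the total rate of crossing calls. For
`Y = 0` the lost budget `4/(D M)` pays for the crossing probability. For `Y > 0` the decrease of the
base pays for the growth. -/
theorem weight_drift_le {M D i Y : ℕ} (hi : i < M) (hD : 0 < D) {R : ℝ}
    (hR : R ≤ 3 * Y + 2 / D) :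
    weight eps M D (i + 1) Y + increment eps M (i + 1) Y * (1 / M * R) ≤ weight eps M D i Y := by
  have hM : (0 : ℝ) < M := by exact_mod_cast (by omega : 0 < M)
  have hD1 : (1 : ℝ) ≤ D := by exact_mod_cast hD
  by_cases hY : Y = 0
  · subst hY
    simp only [weight, increment, if_true, one_mul]
    have h1 : ((M - i : ℕ) : ℝ) = (M - (i + 1) : ℕ) + 1 := by
      rw [show M - i = (M - (i + 1)) + 1 by omega]; push_cast; ring
    have h2 : R ≤ 2 / D := by simpa using hR
    have h3 : 1 / M * R ≤ 1 / M * (4 / D) := by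
      gcongr
      refine h2.trans ?_
      gcongr
      norm_num
    rw [h1, add_div, add_mul]
    linarith
  · simp only [weight, increment, hY, if_false]
    set l := base eps M (i + 1) with hl
    have hl1 : 1 ≤ l := one_le_base M (i + 1)
    have hl2 : l ≤ 2 := base_le_two M (i + 1)
    have hY1 : (1 : ℝ) ≤ Y := by exact_mod_cast Nat.one_le_iff_ne_zero.2 hY
    have hR' : R ≤ 6 * Y := by
      have : 2 / (D : ℝ) ≤ 2 := div_le_self (by norm_num) hD1
      linarith
    -- The factor `12` is twice the `6` of `hR'`, because `l ≤ 2`. Bernoulli's inequality then lifts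
    -- the estimate to the power `Y`.
    have h1 : l * (1 + 6 / M * (l - 1)) ≤ base eps M i := by
      have h2 := base_succ hi
      rw [← hl] at h2
      have h3 : 0 ≤ 6 / (M : ℝ) * (l - 1) := mul_nonneg (by positivity) (by linarith)
      have h4 : base eps M i = l + 2 * (6 / M * (l - 1)) := by
        have : base eps M i = 1 + (l - 1) * (1 + 12 / M) := by linarith
        rw [this]; ring
      rw [h4]
      nlinarith
    have h5 : (0 : ℝ) ≤ 6 / M * (l - 1) := mul_nonneg (by positivity) (by linarith)
    calc l ^ Y + l ^ Y * (l - 1) * (1 / M * R)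
        ≤ l ^ Y + l ^ Y * (l - 1) * (1 / M * (6 * Y)) := by
          have : 0 ≤ l ^ Y * (l - 1) := mul_nonneg (by positivity) (by linarith)
          gcongr
      _ = l ^ Y * (1 + Y * (6 / M * (l - 1))) := by ring
      _ ≤ l ^ Y * (1 + 6 / M * (l - 1)) ^ Y := by
          gcongr
          exact one_add_mul_le_pow (by linarith) Y
      _ = (l * (1 + 6 / M * (l - 1))) ^ Y := (mul_pow _ _ _).symm
      _ ≤ base eps M i ^ Y := by
          gcongr

/-- The potential of a state, `i` grid intervals after the start of the current unit of time. -/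
def potential (M D m i : ℕ) (s : Finset (Fin n) × List (Finset (Fin n))) : ℝ :=
  -- The cap freezes the potential once the bottleneck may be lost. The `max` below anticipates the
  -- filling of the barrier to `D + 1` nodes, which therefore costs nothing.
  if m ≤ (barrier D s.2).card then (1 + eps) ^ m
  else (1 + eps) ^ max (barrier D s.2).card (D + 1) *
    weight eps M D i (s.1 \ barrier D s.2).card

theorem potential_nonneg (M D m i : ℕ) (s : Finset (Fin n) × List (Finset (Fin n))) :
    0 ≤ potential M D m i s := by
  have := eps_pos
  have h := one_le_weight M D i (s.1 \ barrier D s.2).card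
  unfold potential
  split_ifs
  · positivity
  · exact mul_nonneg (by positivity) (by linarith)

/-- At the end of a unit the base is exactly `1 + eps`, so outside nodes already weigh as much as
barrier nodes and can join the barrier. The only loss is the fresh budget `1 + 4/D` for the next
unit. -/
theorem potential_cons_le {M D m : ℕ} (hM : 0 < M) (hDn : D + 1 ≤ n)
    (s : Finset (Fin n) × List (Finset (Fin n))) :
    potential M D m 0 (s.1, s.1 :: s.2) ≤ (1 + 4 / D) * potential M D m M s := by
  have he := eps_pos
  have hβ : (1 : ℝ) ≤ 1 + 4 / D := by
    have : (0 : ℝ) ≤ 4 / D := by positivity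
    linarith
  have hθ : (1 : ℝ) ≤ 1 + eps := by linarith
  set A := barrier D s.2 with hA
  have hA' : barrier D (s.1 :: s.2) = fill D (A ∪ s.1) := rfl
  have hcard : (fill D (A ∪ s.1)).card = max (A.card + (s.1 \ A).card) (D + 1) := by
    rw [card_fill hDn, ← Finset.union_sdiff_self_eq_union,
      Finset.card_union_of_disjoint Finset.disjoint_sdiff]
  have hw : (1 + eps) ^ max A.card (D + 1) * weight eps M D M (s.1 \ A).card =
      (1 + eps) ^ (max A.card (D + 1) + (s.1 \ A).card) := by
    rw [pow_add]
    congr 1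
    unfold weight
    split_ifs with h
    · simp [h]
    · rw [base_last]
  simp only [potential, hA', hcard, ← hA]
  have hempty : s.1 \ fill D (A ∪ s.1) = ∅ :=
    Finset.sdiff_eq_empty_iff_subset.2 (Finset.subset_union_right.trans (subset_fill D _))
  rw [hempty, hw]
  have hM' : (M : ℝ) ≠ 0 := by positivity
  split_ifs with h1 h2 h2
  · exact le_mul_of_one_le_left (by positivity) hβ
  · refine (pow_le_pow_right₀ hθ ?_).trans (le_mul_of_one_le_left (by positivity) hβ)
    exact h1.trans (by omega)
  · omega
  · rw [mul_comm]
    have : weight eps M D 0 (∅ : Finset (Fin n)).card = 1 + 4 / D := by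
      simp [weight, hM']
    rw [this]
    gcongr
    omega

/-- A bound on the increase of `potential` when one more node outside the barrier is informed. -/
def potentialIncrement (M D m i : ℕ) (s : Finset (Fin n) × List (Finset (Fin n))) : ℝ :=
  if m ≤ (barrier D s.2).card then 0 else (1 + eps) ^ max (barrier D s.2).card (D + 1) *
    increment eps M i (s.1 \ barrier D s.2).card

theorem potentialIncrement_nonneg (M D m i : ℕ) (s : Finset (Fin n) × List (Finset (Fin n))) :
    0 ≤ potentialIncrement M D m i s := by
  have := eps_pos
  unfold potentialIncrement
  split_ifs
  · exact le_rfl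
  · exact mul_nonneg (by positivity) (increment_nonneg _ _ _)

/-- Below the cap there is room for a bottleneck, since `|A| + D + 1 ≤ n`, and `weight_drift_le`
applies with the rate of crossing calls. Above it the potential is constant and the increment is
zero. -/
theorem potential_drift_le {D m M i : ℕ} (hD : 0 < D) (hDn : D + 1 ≤ n) (hm : m + D ≤ n)
    (hi : i < M) (s : Finset (Fin n) × List (Finset (Fin n))) :
    ENNReal.ofReal (potential M D m (i + 1) s) +
      ∑ u, ∑ w, (if Crosses (bottleneckNetwork n D s.2) (barrier D s.2) s.1 u w then
        ENNReal.ofReal (potentialIncrement M D m (i + 1) s) else 0) *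
        (ENNReal.ofReal (1 / M) *
          (((bottleneckNetwork n D s.2).neighborFinset u).card : ℝ≥0∞)⁻¹) ≤
      ENNReal.ofReal (potential M D m i s) := by
  have he := eps_pos
  by_cases hc : m ≤ (barrier D s.2).card
  · simp [potential, potentialIncrement, hc]
  set G := bottleneckNetwork n D s.2 with hG
  have hb : IsBottleneck D (barrier D s.2) G := isBottleneck_network hD hDn s.2 (by omega)
  set q := potentialIncrement M D m (i + 1) s with hq
  have hq0 : 0 ≤ q := potentialIncrement_nonneg _ _ _ _ _
  have hterm : ∀ u w, (if Crosses G (barrier D s.2) s.1 u w then ENNReal.ofReal q else 0) *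
      (ENNReal.ofReal (1 / M) * ((G.neighborFinset u).card : ℝ≥0∞)⁻¹) =
      ENNReal.ofReal (q * (1 / M *
        if Crosses G (barrier D s.2) s.1 u w then 1 / (G.degree u : ℝ) else 0)) := by
    intro u w
    split_ifs
    · have hd : (0 : ℝ) < G.degree u := by exact_mod_cast hD.trans_le (hb.le_degree u)
      rw [SimpleGraph.card_neighborFinset_eq_degree, ENNReal.ofReal_mul hq0,
        ENNReal.ofReal_mul (by positivity), one_div (G.degree u : ℝ), ENNReal.ofReal_inv_of_pos hd,
        ENNReal.ofReal_natCast]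
    · simp
  have hpos : ∀ u w, 0 ≤ q * (1 / M *
      if Crosses G (barrier D s.2) s.1 u w then 1 / (G.degree u : ℝ) else 0) := fun u w => by
    have : (0 : ℝ) ≤ if Crosses G (barrier D s.2) s.1 u w then 1 / (G.degree u : ℝ) else 0 := by
      split_ifs <;> positivity
    positivity
  simp only [hterm]
  simp only [← ENNReal.ofReal_sum_of_nonneg fun w _ => hpos _ w]
  rw [← ENNReal.ofReal_sum_of_nonneg fun u _ => Finset.sum_nonneg fun w _ => hpos u w,
    ← ENNReal.ofReal_add (potential_nonneg _ _ _ _ _)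
      (Finset.sum_nonneg fun u _ => Finset.sum_nonneg fun w _ => hpos u w)]
  refine ENNReal.ofReal_le_ofReal ?_
  simp only [← Finset.mul_sum]
  have h := weight_drift_le hi hD (hb.sum_crosses_le hD s.1)
  rw [hq]
  simp only [potential, potentialIncrement, if_neg hc]
  rw [mul_assoc, ← mul_add]
  gcongr

/-- The pathwise counterpart of the drift bound: one step adds at most one outside node, and then
some crossing call has occurred, so the sum over possible calls dominates the increase. -/
theorem potential_step_le {Ω : Type*} {M D m i : ℕ}
    (s : Finset (Fin n) × List (Finset (Fin n))) (G : SimpleGraph (Fin n)) (N : Fin n → ℕ)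
    (c : Fin n → Finset (Fin n) → Fin n) (E : Fin n → Fin n → Set Ω) {ω : Ω}
    (hE : ∀ u w, N u ≠ 0 → c u (G.neighborFinset u) = w → ω ∈ E u w) :
    ENNReal.ofReal (potential M D m i (step G s.1 N c, s.2)) ≤
      ENNReal.ofReal (potential M D m i s) + ∑ u, ∑ w,
        (if Crosses G (barrier D s.2) s.1 u w then
          ENNReal.ofReal (potentialIncrement M D m i s) else 0) * (E u w).indicator 1 ω := by
  have he := eps_pos
  rcases card_step_sdiff_le (G := G) (A := barrier D s.2) (S := s.1) N c with
    h | ⟨h, u, w, hc, h1, h2⟩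
  · refine le_add_right (le_of_eq ?_)
    simp only [potential, h]
  · set I : Fin n → Fin n → ℝ≥0∞ := fun u w => (if Crosses G (barrier D s.2) s.1 u w then
      ENNReal.ofReal (potentialIncrement M D m i s) else 0) * (E u w).indicator 1 ω with hI
    have h3 : ENNReal.ofReal (potentialIncrement M D m i s) ≤ ∑ u, ∑ w, I u w := by
      have h4 : I u w = ENNReal.ofReal (potentialIncrement M D m i s) := by
        simp only [hI, if_pos hc, Set.indicator_of_mem (hE u w h1 h2), Pi.one_apply, mul_one]
      rw [← h4]
      exact (Finset.single_le_sum (f := fun w => I u w) (fun _ _ => zero_le)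
        (Finset.mem_univ w)).trans (Finset.single_le_sum (f := fun u => ∑ w, I u w)
        (fun _ _ => zero_le) (Finset.mem_univ u))
    refine le_trans ?_ (add_le_add le_rfl h3)
    rw [← ENNReal.ofReal_add (potential_nonneg _ _ _ _ _) (potentialIncrement_nonneg _ _ _ _ _)]
    refine ENNReal.ofReal_le_ofReal ?_
    simp only [potential, potentialIncrement, h]
    split_ifs
    · simp
    · rw [← mul_add]
      gcongr
      exact weight_succ_le _ _ _ _

/-! ### The expected potential along the simulation -/

theorem rrun_succ_fst {Ω : Type*} {arr : Fin n → ℕ → Ω → ℝ}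
    {ch : Fin n → ℕ → Ω → Finset (Fin n) → Fin n} {net : DynamicNetwork n} {v₀ : Fin n} {M j : ℕ}
    {ω : Ω} : (rrun net v₀ M arr ch (j + 1) ω).1 =
      step (net (rrun net v₀ M arr ch j ω).2) (rrun net v₀ M arr ch j ω).1
        (fun v => rticks M arr j v ω)
        fun v => ch v (∑ i ∈ Finset.range j, rticks M arr i v ω) ω := by
  simp only [rrun, run]
  rfl

theorem rrun_succ_of_not_dvd {Ω : Type*} {arr : Fin n → ℕ → Ω → ℝ}
    {ch : Fin n → ℕ → Ω → Finset (Fin n) → Fin n} {net : DynamicNetwork n} {v₀ : Fin n} {M j : ℕ}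
    (h : ¬ M ∣ j + 1)
    {ω : Ω} : rrun net v₀ M arr ch (j + 1) ω =
      ((rrun net v₀ M arr ch (j + 1) ω).1, (rrun net v₀ M arr ch j ω).2) := by
  simp only [rrun, run, if_neg h]

theorem rrun_succ_of_dvd {Ω : Type*} {arr : Fin n → ℕ → Ω → ℝ}
    {ch : Fin n → ℕ → Ω → Finset (Fin n) → Fin n} {net : DynamicNetwork n} {v₀ : Fin n} {M j : ℕ}
    (h : M ∣ j + 1)
    {ω : Ω} : rrun net v₀ M arr ch (j + 1) ω =
      ((rrun net v₀ M arr ch (j + 1) ω).1,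
        (rrun net v₀ M arr ch (j + 1) ω).1 :: (rrun net v₀ M arr ch j ω).2) := by
  simp only [rrun, run, if_pos h]

section
variable {Ω : Type*} [MeasurableSpace Ω] {P : Measure Ω}
  {arr : Fin n → ℕ → Ω → ℝ} {ch : Fin n → ℕ → Ω → Finset (Fin n) → Fin n}

theorem IsAsyncRandomness.measurable_call (hR : IsAsyncRandomness P arr ch)
    (net : DynamicNetwork n) (v₀ : Fin n) (M j : ℕ) (u w : Fin n)
    (D : Finset (Fin n) × List (Finset (Fin n)) → ℝ≥0∞)
    (X : Finset (Fin n) × List (Finset (Fin n)) → Finset (Fin n)) :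
    Measurable fun ω => D (rrun net v₀ M arr ch j ω) *
        (callEvent M arr ch j u w (X (rrun net v₀ M arr ch j ω))).indicator 1 ω := by
  have h2 : MeasurableSet {ω | ω ∈ callEvent M arr ch j u w (X (rrun net v₀ M arr ch j ω))} := by
    have : {ω | ω ∈ callEvent M arr ch j u w (X (rrun net v₀ M arr ch j ω))} =
        ⋃ Z : Finset (Fin n), {ω | X (rrun net v₀ M arr ch j ω) = Z} ∩
          callEvent M arr ch j u w Z := by
      ext ω; simp
    rw [this]
    refine MeasurableSet.iUnion fun Z => MeasurableSet.inter ?_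
      (hR.measurableSet_callEvent M j u w Z)
    let : MeasurableSpace (Finset (Fin n)) := ⊤
    exact hR.measurable_comp_rrun net v₀ M j X (MeasurableSet.of_discrete (s := {Z}))
  refine (hR.measurable_comp_rrun net v₀ M j D).mul ?_
  exact measurable_one.indicator h2

theorem lintegral_add_sum_sum {f : Ω → ℝ≥0∞} {g : Fin n → Fin n → Ω → ℝ≥0∞} (hf : Measurable f)
    (hg : ∀ u w, Measurable (g u w)) :
    ∫⁻ ω, (f ω + ∑ u, ∑ w, g u w ω) ∂P = ∫⁻ ω, f ω ∂P + ∑ u, ∑ w, ∫⁻ ω, g u w ω ∂P := by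
  rw [lintegral_add_left hf, lintegral_finsetSum _ fun u _ =>
    Finset.measurable_fun_sum _ fun w _ => hg u w]
  congr 1
  exact Finset.sum_congr rfl fun u _ => lintegral_finsetSum _ fun w _ => hg u w

/-- An inequality of integrals in which the summands of a double sum are compared in mean. -/
theorem lintegral_le_of_sum_sum {f L U : Ω → ℝ≥0∞} {g g' : Fin n → Fin n → Ω → ℝ≥0∞}
    (hf : Measurable f) (hg : ∀ u w, Measurable (g u w)) (hg' : ∀ u w, Measurable (g' u w))
    (hL : ∀ ω, L ω ≤ f ω + ∑ u, ∑ w, g u w ω)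
    (h : ∀ u w, ∫⁻ ω, g u w ω ∂P ≤ ∫⁻ ω, g' u w ω ∂P)
    (hU : ∀ ω, f ω + ∑ u, ∑ w, g' u w ω ≤ U ω) : ∫⁻ ω, L ω ∂P ≤ ∫⁻ ω, U ω ∂P := by
  refine (lintegral_mono hL).trans (le_trans ?_ (lintegral_mono hU))
  rw [lintegral_add_sum_sum hf hg, lintegral_add_sum_sum hf hg']
  exact add_le_add le_rfl (Finset.sum_le_sum fun u _ => Finset.sum_le_sum fun w _ => h u w)

/-- Only the informed set is updated and the history is kept, so that the statement also covers the
last interval of a unit. The extension of the history there is left to `potential_cons_le`. -/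
theorem IsAsyncRandomness.lintegral_potential_step_le (hR : IsAsyncRandomness P arr ch)
    {D m M i : ℕ} (hD : 0 < D) (hDn : D + 1 ≤ n) (hm : m + D ≤ n) (hi : i < M) (v₀ : Fin n)
    (j : ℕ) :
    ∫⁻ ω, ENNReal.ofReal (potential M D m (i + 1)
        ((rrun (bottleneckNetwork n D) v₀ M arr ch (j + 1) ω).1,
          (rrun (bottleneckNetwork n D) v₀ M arr ch j ω).2)) ∂P ≤
      ∫⁻ ω, ENNReal.ofReal (potential M D m i
        (rrun (bottleneckNetwork n D) v₀ M arr ch j ω)) ∂P := by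
  set net := bottleneckNetwork n D with hnet
  set r : Ω → Finset (Fin n) × List (Finset (Fin n)) := rrun net v₀ M arr ch j with hr
  set F : Fin n → Fin n → Finset (Fin n) × List (Finset (Fin n)) → ℝ≥0∞ := fun u w s =>
    if Crosses (net s.2) (barrier D s.2) s.1 u w then
      ENNReal.ofReal (potentialIncrement M D m (i + 1) s) else 0 with hF
  set X : Fin n → Finset (Fin n) × List (Finset (Fin n)) → Finset (Fin n) := fun u s =>
    (net s.2).neighborFinset u with hX
  have hpot : Measurable fun ω => ENNReal.ofReal (potential M D m (i + 1) (r ω)) :=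
    hR.measurable_comp_rrun net v₀ M j fun s => ENNReal.ofReal (potential M D m (i + 1) s)
  have hcall : ∀ u w, Measurable fun ω =>
      F u w (r ω) * (callEvent M arr ch j u w (X u (r ω))).indicator 1 ω := fun u w =>
    hR.measurable_call net v₀ M j u w (F u w) (X u)
  have hrate : ∀ u w, Measurable fun ω =>
      F u w (r ω) * (ENNReal.ofReal (1 / M) * ((X u (r ω)).card : ℝ≥0∞)⁻¹) := by
    intro u w
    have h := hR.measurable_comp_rrun net v₀ M j fun s =>
      F u w s * (ENNReal.ofReal (1 / M) * ((X u s).card : ℝ≥0∞)⁻¹)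
    exact h
  have hcomp : ∀ u w, ∫⁻ ω, F u w (r ω) * (callEvent M arr ch j u w (X u (r ω))).indicator 1 ω ∂P ≤
      ∫⁻ ω, F u w (r ω) * (ENNReal.ofReal (1 / M) * ((X u (r ω)).card : ℝ≥0∞)⁻¹) ∂P := by
    intro u w
    have hF' : ∀ s, F u w s ≠ 0 → w ∈ X u s := by
      intro s hs
      simp only [hF, ne_eq, ite_eq_right_iff, Classical.not_imp] at hs
      simpa only [hX, SimpleGraph.mem_neighborFinset] using hs.1.1
    exact hR.lintegral_call_le net v₀ M j u w (F u w) (X u) hF'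
  have hlow : ∀ ω, ENNReal.ofReal (potential M D m (i + 1)
      ((rrun net v₀ M arr ch (j + 1) ω).1, (r ω).2)) ≤
      ENNReal.ofReal (potential M D m (i + 1) (r ω)) + ∑ u, ∑ w,
        F u w (r ω) * (callEvent M arr ch j u w (X u (r ω))).indicator 1 ω := by
    intro ω
    rw [rrun_succ_fst]
    exact potential_step_le (r ω) (net (r ω).2) (fun v => rticks M arr j v ω)
      (fun v => ch v (∑ i ∈ Finset.range j, rticks M arr i v ω) ω)
      (fun u w => callEvent M arr ch j u w (X u (r ω))) fun u w h1 h2 => ⟨h1, h2⟩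
  have hup : ∀ ω, ENNReal.ofReal (potential M D m (i + 1) (r ω)) + ∑ u, ∑ w,
        F u w (r ω) * (ENNReal.ofReal (1 / M) * ((X u (r ω)).card : ℝ≥0∞)⁻¹) ≤
      ENNReal.ofReal (potential M D m i (r ω)) := fun ω => potential_drift_le hD hDn hm hi (r ω)
  clear_value F X r
  exact lintegral_le_of_sum_sum hpot hcall hrate hlow hcomp hup

theorem IsAsyncRandomness.lintegral_potential_unit_le (hR : IsAsyncRandomness P arr ch)
    {D m M : ℕ} (hD : 0 < D) (hDn : D + 1 ≤ n) (hm : m + D ≤ n) (hM : 0 < M) (v₀ : Fin n)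
    (t : ℕ) :
    ∫⁻ ω, ENNReal.ofReal (potential M D m 0
        (rrun (bottleneckNetwork n D) v₀ M arr ch ((t + 1) * M) ω)) ∂P ≤
      ENNReal.ofReal (1 + 4 / D) * ∫⁻ ω, ENNReal.ofReal (potential M D m 0
        (rrun (bottleneckNetwork n D) v₀ M arr ch (t * M) ω)) ∂P := by
  have hβ : (0 : ℝ) ≤ 1 + 4 / D := by positivity
  have hin : ∀ i < M, ∫⁻ ω, ENNReal.ofReal (potential M D m i
      (rrun (bottleneckNetwork n D) v₀ M arr ch (t * M + i) ω)) ∂P ≤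
      ∫⁻ ω, ENNReal.ofReal (potential M D m 0
        (rrun (bottleneckNetwork n D) v₀ M arr ch (t * M) ω)) ∂P := by
    intro i
    induction i with
    | zero => exact fun _ => le_rfl
    | succ i ih =>
      intro hi
      refine le_trans (le_of_eq ?_) ((hR.lintegral_potential_step_le hD hDn hm
        (by omega : i < M) v₀ (t * M + i)).trans (ih (by omega)))
      have hdvd : ¬ M ∣ t * M + i + 1 := by
        rw [add_assoc, Nat.dvd_add_right (Dvd.intro_left t rfl)]
        exact fun hd => absurd (Nat.le_of_dvd (by omega) hd) (by omega)
      refine lintegral_congr fun ω => ?_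
      rw [← add_assoc, ← rrun_succ_of_not_dvd hdvd]
  have h3 : (t + 1) * M = t * M + (M - 1) + 1 := by
    rw [add_mul]; omega
  have hlast := (hR.lintegral_potential_step_le hD hDn hm
    (by omega : M - 1 < M) v₀ (t * M + (M - 1))).trans (hin (M - 1) (by omega))
  rw [Nat.sub_add_cancel hM] at hlast
  refine le_trans ?_ (mul_le_mul_right hlast _)
  rw [← lintegral_const_mul' _ _ ENNReal.ofReal_ne_top]
  refine lintegral_mono fun ω => ?_
  rw [← ENNReal.ofReal_mul hβ]
  refine ENNReal.ofReal_le_ofReal ?_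
  have h4 := potential_cons_le (m := m) hM hDn
    ((rrun (bottleneckNetwork n D) v₀ M arr ch (t * M + (M - 1) + 1) ω).1,
      (rrun (bottleneckNetwork n D) v₀ M arr ch (t * M + (M - 1)) ω).2)
  refine le_trans (le_of_eq ?_) h4
  rw [h3]
  have hdvd : M ∣ t * M + (M - 1) + 1 := h3 ▸ Dvd.intro_left _ rfl
  rw [← rrun_succ_of_dvd hdvd]

theorem IsAsyncRandomness.lintegral_potential_le [IsProbabilityMeasure P]
    (hR : IsAsyncRandomness P arr ch)
    {D m M : ℕ} (hD : 0 < D) (hDn : D + 1 ≤ n) (hm : m + D ≤ n) (hm0 : 0 < m) (hM : 0 < M)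
    (v₀ : Fin n) (T : ℕ) :
    ∫⁻ ω, ENNReal.ofReal (potential M D m 0
        (rrun (bottleneckNetwork n D) v₀ M arr ch (T * M) ω)) ∂P ≤
      ENNReal.ofReal ((1 + 4 / D) ^ T * ((1 + eps) ^ (D + 1) * 2)) := by
  have he := eps_pos
  have hβ : (0 : ℝ) ≤ 1 + 4 / D := by positivity
  induction T with
  | zero =>
    -- The barrier of the empty history is empty, so `v₀` counts as one outside node, of weight at
    -- most `2`.
    have : ∀ ω, potential M D m 0 (rrun (bottleneckNetwork n D) v₀ M arr ch (0 * M) ω) ≤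
        (1 + eps) ^ (D + 1) * 2 := by
      intro ω
      simp only [zero_mul, rrun, run, potential, barrier, Finset.card_empty, not_le.2 hm0,
        if_false, Finset.sdiff_empty, Finset.card_singleton, weight, one_ne_zero, pow_one]
      rw [max_eq_right (Nat.zero_le _)]
      gcongr
      exact base_le_two _ _
    refine (lintegral_mono fun ω => ENNReal.ofReal_le_ofReal (this ω)).trans ?_
    simp
  | succ T ih =>
    refine (hR.lintegral_potential_unit_le hD hDn hm hM v₀ T).trans ?_
    refine (mul_le_mul_right ih _).trans (le_of_eq ?_)
    rw [← ENNReal.ofReal_mul hβ, pow_succ]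
    congr 1
    ring

/-! ### From the expected potential to the spread time -/

theorem barrier_state_mono {D : ℕ} {arr : Fin n → ℕ → ℝ}
    {ch : Fin n → ℕ → Finset (Fin n) → Fin n} (net : DynamicNetwork n) (v₀ : Fin n) :
    Monotone fun t => barrier D (state net v₀ arr ch t).2 :=
  monotone_nat_of_le_succ fun _ => Finset.subset_union_left.trans (subset_fill D _)

theorem state_subset_barrier {D : ℕ} {arr : Fin n → ℕ → ℝ}
    {ch : Fin n → ℕ → Finset (Fin n) → Fin n} (net : DynamicNetwork n) (v₀ : Fin n) (t : ℕ) :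
    (state net v₀ arr ch (t + 1)).1 ⊆ barrier D (state net v₀ arr ch (t + 1)).2 :=
  Finset.subset_union_right.trans (subset_fill D _)

/-- It is unlikely that the rumor spreads in the bottleneck network before time `T`. -/
theorem IsAsyncRandomness.measure_spreadTime_lt_le [IsProbabilityMeasure P]
    (hR : IsAsyncRandomness P arr ch)
    {D : ℕ} (hD : 0 < D) (hDn : 2 * (D + 1) ≤ n) (v₀ : Fin n) (T : ℕ) :
    P {ω | spreadTime (bottleneckNetwork n D) v₀ (fun v k => arr v k ω) (fun v k => ch v k ω) <
        T} ≤ ENNReal.ofReal (1 / n) +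
      ENNReal.ofReal ((1 + 4 / D) ^ T * ((1 + eps) ^ (D + 1) * 2) / (1 + eps) ^ (n - D)) := by
  have he := eps_pos
  have hn : (0 : ℝ) < n := by exact_mod_cast (by omega : 0 < n)
  set net := bottleneckNetwork n D with hnet
  -- The union bound over `T * M` intervals gives `T * n ^ 2 / M ≤ 1 / n`. The cap `m = n - D` is
  -- chosen so that barriers with fewer than `m` nodes leave `D + 1` nodes free.
  set M := T * n ^ 3 + 1 with hM
  set m := n - D with hm
  have hMpos : (0 : ℝ) < M := by exact_mod_cast Nat.succ_pos _
  set bad : Set Ω := ⋃ j ∈ Finset.range (T * M), {ω | 2 ≤ ∑ v, rticks M arr j v ω} with hbad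
  set big : Set Ω := {ω | ENNReal.ofReal ((1 + eps) ^ m) ≤
    ENNReal.ofReal (potential M D m 0 (rrun net v₀ M arr ch (T * M) ω))} with hbig
  have hPbad : P bad ≤ ENNReal.ofReal (1 / n) := by
    refine (measure_biUnion_finset_le _ _).trans ((Finset.sum_le_sum fun j _ =>
      hR.measure_two_le_sum_rticks M j).trans ?_)
    rw [Finset.sum_const, nsmul_eq_mul, ← ENNReal.ofReal_natCast,
      ← ENNReal.ofReal_mul (by positivity), Finset.card_range]
    refine ENNReal.ofReal_le_ofReal ?_
    have h1 : (T : ℝ) * n ^ 3 ≤ M := by rw [hM]; push_cast; linarith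
    have h2 : ((T * M : ℕ) : ℝ) * (n ^ 2 * (1 / M) ^ 2) = T * n ^ 3 / M * (1 / n) := by
      push_cast
      field_simp
    rw [h2]
    refine mul_le_of_le_one_left (by positivity) ?_
    rw [div_le_one hMpos]
    exact h1
  have hPbig : P big ≤ ENNReal.ofReal
      ((1 + 4 / D) ^ T * ((1 + eps) ^ (D + 1) * 2) / (1 + eps) ^ m) := by
    have hθ : 0 < (1 + eps) ^ m := by positivity
    rw [ENNReal.ofReal_div_of_pos hθ]
    refine (meas_ge_le_lintegral_div (hR.measurable_comp_rrun net v₀ M (T * M) fun s =>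
      ENNReal.ofReal (potential M D m 0 s)).aemeasurable
      (by simpa using hθ) ENNReal.ofReal_ne_top).trans ?_
    exact ENNReal.div_le_div_right (hR.lintegral_potential_le hD (by omega) (by omega) (by omega)
      (Nat.succ_pos _) v₀ T) _
  refine le_trans ?_ ((measure_union_le bad big).trans (add_le_add hPbad hPbig))
  refine measure_mono_ae ?_
  filter_upwards [hR.ae_regularTicks] with ω hω hlt
  by_cases hb : ω ∈ bad
  · exact Or.inl hb
  right
  have h1 : ∀ j < T * M, ∑ v, ticks M (fun v k => arr v k ω) j v ≤ 1 := by
    intro j hj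
    by_contra h
    refine hb ?_
    simp only [hbad, Set.mem_iUnion, Finset.mem_range]
    exact ⟨j, hj, not_le.1 h⟩
  have hrun := run_eq_state net v₀ (Nat.succ_pos _) (fun v k => ch v k ω) hω h1 T le_rfl
  obtain ⟨t, ht, htu⟩ := exists_state_eq_univ_of_spreadTime_lt hlt
  -- Everyone is informed at the integer time `t + 1 ≤ T`, and barriers only grow, so at time `T`
  -- the barrier is everything and the cap is reached.
  have h2 : barrier D (rrun net v₀ M arr ch (T * M) ω).2 = Finset.univ := by
    refine Finset.univ_subset_iff.1 ?_
    rw [rrun, hrun, ← htu]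
    exact (state_subset_barrier net v₀ t).trans (barrier_state_mono net v₀ ht)
  refine ENNReal.ofReal_le_ofReal ?_
  rw [potential, h2, if_pos (by simp [hm])]

end

/-- If all graphs are connected with absolute diligence at least `a`, then `absTime` is small. -/
theorem absTime_le {G : ℕ → SimpleGraph (Fin n)} {a : ℝ} (ha : 0 < a)
    (hG : ∀ t, (G t).Connected ∧ a ≤ absDiligence (G t)) :
    (absTime G : ℝ≥0∞) ≤ ENNReal.ofReal (2 * n / a + 1) := by
  set t := ⌈2 * n / a⌉₊ with ht
  have h1 : absTime G ≤ t := by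
    refine iInf₂_le t ?_
    have h2 : (2 * n : ℝ) / a ≤ t := Nat.le_ceil _
    calc (2 * n : ℝ) ≤ t * a := (div_le_iff₀ ha).1 h2
      _ ≤ ∑ p ∈ Finset.range (t + 1), a := by
        rw [Finset.sum_const, Finset.card_range, nsmul_eq_mul]
        push_cast
        nlinarith
      _ ≤ _ := Finset.sum_le_sum fun p _ => by rw [if_pos (hG p).1]; exact (hG p).2
  have h3 : (absTime G : ℝ≥0∞) ≤ ((t : ℕ∞) : ℝ≥0∞) := ENat.toENNReal_le.2 h1
  refine h3.trans ?_
  rw [ENat.toENNReal_coe, ← ENNReal.ofReal_natCast]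
  exact ENNReal.ofReal_le_ofReal (Nat.ceil_lt_add_one (by positivity)).le

/-- The numerical estimate behind the choice of the constants. -/
theorem tail_bound {D T : ℕ} {ρ : ℝ} (hn : 10 ≤ n) (hD : 0 < D)
    (hD1 : 1 / ρ ≤ D) (hD2 : (D : ℝ) ≤ n / 10 + 1)
    (hT : (T : ℝ) ≤ Real.log (1 + eps) / 10 * n / ρ + 1) :
    (1 + 4 / (D : ℝ)) ^ T * ((1 + eps) ^ (D + 1) * 2) / (1 + eps) ^ (n - D) ≤
      5 * Real.exp (4 + 3 * Real.log (1 + eps)) / Real.log (1 + eps) / n := by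
  have he := eps_pos
  set L := Real.log (1 + eps) with hL
  have hLpos : 0 < L := Real.log_pos (by linarith)
  have hD' : (1 : ℝ) ≤ D := by exact_mod_cast hD
  have hn' : (10 : ℝ) ≤ n := by exact_mod_cast hn
  have hpow : ∀ k : ℕ, (1 + eps) ^ k = Real.exp (k * L) := fun k => by
    rw [Real.exp_nat_mul, hL, Real.exp_log (by linarith)]
  have h1 : (1 + 4 / (D : ℝ)) ^ T ≤ Real.exp (T * (4 / D)) := by
    rw [Real.exp_nat_mul]
    gcongr
    rw [add_comm]
    exact Real.add_one_le_exp _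
  have h2 : T * (4 / (D : ℝ)) ≤ 4 * (L / 10 * n) + 4 := by
    have h3 : (T : ℝ) ≤ L / 10 * n * D + 1 := by
      refine hT.trans ?_
      rw [div_eq_mul_one_div]
      gcongr
    calc T * (4 / (D : ℝ)) ≤ (L / 10 * n * D + 1) * (4 / D) := by gcongr
      _ = 4 * (L / 10 * n) + 4 / D := by field_simp
      _ ≤ _ := by
        have : 4 / (D : ℝ) ≤ 4 := div_le_self (by norm_num) hD'
        linarith
  have hcast : ((n - D : ℕ) : ℝ) = n - D := by
    have : (D : ℝ) ≤ n := by linarith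
    rw [Nat.cast_sub (by exact_mod_cast this)]
  rw [hpow, hpow, hcast]
  -- The exponent is at most `(4/10) L n + 4 + (D + 1) L - (n - D) L`. Since `D ≤ n/10 + 1`, this is
  -- at most `4 + 3 L - (2/5) L n`.
  have h4 : (1 + 4 / (D : ℝ)) ^ T * (Real.exp ((D + 1 : ℕ) * L) * 2) / Real.exp ((n - D) * L) ≤
      2 * Real.exp (4 + 3 * L) * Real.exp (-(2 / 5 * L * n)) := by
    rw [div_le_iff₀ (Real.exp_pos _)]
    calc (1 + 4 / (D : ℝ)) ^ T * (Real.exp ((D + 1 : ℕ) * L) * 2)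
        ≤ Real.exp (4 * (L / 10 * n) + 4) * (Real.exp ((D + 1 : ℕ) * L) * 2) := by
          gcongr
          exact h1.trans (Real.exp_le_exp.2 h2)
      _ = 2 * Real.exp (4 * (L / 10 * n) + 4 + (D + 1) * L) := by
          rw [Real.exp_add _ ((D + 1) * L)]; push_cast; ring
      _ ≤ 2 * Real.exp (4 + 3 * L + -(2 / 5 * L * n) + (n - D) * L) := by
          refine mul_le_mul_of_nonneg_left (Real.exp_le_exp.2 ?_) zero_le_two
          nlinarith
      _ = _ := by rw [Real.exp_add _ ((n - D) * L), Real.exp_add (4 + 3 * L)]; ring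
  refine h4.trans ?_
  have hx : 0 < 2 / 5 * L * n := by positivity
  have h5 : Real.exp (-(2 / 5 * L * n)) ≤ 1 / (2 / 5 * L * n) := by
    rw [Real.exp_neg, ← one_div]
    exact one_div_le_one_div_of_le hx (by linarith [Real.add_one_le_exp (2 / 5 * L * n)])
  calc _ ≤ 2 * Real.exp (4 + 3 * L) * (1 / (2 / 5 * L * n)) := by gcongr
    _ = _ := by field_simp

end Rumor

end

theorem theorem4 :
    ∃ c₁ c₂ c K C : ℝ, 0 < c₁ ∧ 0 < c₂ ∧ 0 < c ∧ 0 < K ∧ 0 < C ∧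
      ∀ (n : ℕ) (ρ : ℝ), 0 < n → 10 / (n : ℝ) ≤ ρ → ρ ≤ 1 →
        ∃ net : Rumor.DynamicNetwork n,
          (∀ h : List (Finset (Fin n)), (net h).Connected ∧
            c₁ * ρ ≤ Rumor.absDiligence (net h) ∧ Rumor.absDiligence (net h) ≤ c₂ * ρ) ∧
          ∀ (Ω : Type*) [MeasurableSpace Ω] (P : Measure Ω) [IsProbabilityMeasure P]
            (arr : Fin n → ℕ → Ω → ℝ) (ch : Fin n → ℕ → Ω → Finset (Fin n) → Fin n),
            Rumor.IsAsyncRandomness P arr ch → ∀ v₀ : Fin n,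
              P {ω | Rumor.spreadTime net v₀ (fun v k => arr v k ω) (fun v k => ch v k ω) <
                  ENNReal.ofReal (c * n / ρ)} ≤ ENNReal.ofReal (C / n) ∧
              ∀ ω, (Rumor.absTime (Rumor.graphAt net v₀ (fun v k => arr v k ω)
                  (fun v k => ch v k ω)) : ℝ≥0∞) ≤ ENNReal.ofReal (K * n / ρ) := by
  have hL : 0 < Real.log (1 + Rumor.eps) := Real.log_pos (by linarith [Rumor.eps_pos])
  -- As `1/ρ ≤ D ≤ 2/ρ`, the diligence, between `1/(2D)` and `1/D`, lies in `[ρ/4, ρ]`. Then `T_abs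
  -- ≤ 8n/ρ + 1 ≤ 9n/ρ`. The last constant adds the grid error `1/n` to the bound of `tail_bound`.
  refine ⟨1 / 4, 1, Real.log (1 + Rumor.eps) / 10, 9,
    1 + 5 * Real.exp (4 + 3 * Real.log (1 + Rumor.eps)) / Real.log (1 + Rumor.eps),
    by norm_num, one_pos, by positivity, by norm_num, by positivity, ?_⟩
  intro n ρ hn hρn hρ1
  have hn' : (0 : ℝ) < n := by exact_mod_cast hn
  have hρ : 0 < ρ := lt_of_lt_of_le (by positivity) hρn
  have hn10 : (10 : ℝ) ≤ n := by
    have := (div_le_iff₀ hn').1 hρn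
    nlinarith
  have hinv : 1 / ρ ≤ n / 10 := by
    rw [div_le_iff₀ hρ]
    have := (div_le_iff₀ hn').1 hρn
    linarith
  set D := ⌈1 / ρ⌉₊ with hD
  have hD1 : 1 / ρ ≤ D := Nat.le_ceil _
  have hD2 : (D : ℝ) < 1 / ρ + 1 := Nat.ceil_lt_add_one (by positivity)
  have hDpos : 0 < D := Nat.ceil_pos.2 (by positivity)
  have hDn : 2 * (D + 1) ≤ n := by
    have : (2 * (D + 1) : ℝ) ≤ n := by linarith
    exact_mod_cast this
  have hD2' : (D : ℝ) ≤ 2 / ρ := by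
    have : 1 ≤ 1 / ρ := by rw [le_div_iff₀ hρ]; linarith
    have : 2 / ρ = 1 / ρ + 1 / ρ := by ring
    linarith
  have hDpos' : (0 : ℝ) < D := by exact_mod_cast hDpos
  have hnet : ∀ h : List (Finset (Fin n)), (Rumor.bottleneckNetwork n D h).Connected ∧
      1 / 4 * ρ ≤ Rumor.absDiligence (Rumor.bottleneckNetwork n D h) ∧
      Rumor.absDiligence (Rumor.bottleneckNetwork n D h) ≤ 1 * ρ := by
    intro h
    obtain ⟨A, hA⟩ := Rumor.exists_isBottleneck_network hDpos (by omega) h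
    refine ⟨hA.connected, le_trans ?_ (hA.le_absDiligence hDpos (by omega)),
      (hA.absDiligence_le hDpos (by omega)).trans ?_⟩
    · rw [le_div_iff₀ (by positivity)]
      have := (le_div_iff₀ hρ).1 hD2'
      linarith
    · rw [div_le_iff₀ hDpos']
      have := (div_le_iff₀ hρ).1 hD1
      linarith
  refine ⟨Rumor.bottleneckNetwork n D, hnet, ?_⟩
  intro Ω _ P _ arr ch hR v₀
  constructor
  · set T := ⌈Real.log (1 + Rumor.eps) / 10 * n / ρ⌉₊ with hT
    have hT1 : ENNReal.ofReal (Real.log (1 + Rumor.eps) / 10 * n / ρ) ≤ T := by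
      rw [← ENNReal.ofReal_natCast]
      exact ENNReal.ofReal_le_ofReal (Nat.le_ceil _)
    have hT2 : (T : ℝ) ≤ Real.log (1 + Rumor.eps) / 10 * n / ρ + 1 :=
      (Nat.ceil_lt_add_one (by positivity)).le
    refine (measure_mono fun ω hω => ?_).trans ((hR.measure_spreadTime_lt_le hDpos hDn v₀ T).trans
      ((add_le_add le_rfl (ENNReal.ofReal_le_ofReal (Rumor.tail_bound (by exact_mod_cast hn10)
        hDpos hD1 (by linarith) hT2))).trans (le_of_eq ?_)))
    · exact lt_of_lt_of_le hω hT1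
    · rw [← ENNReal.ofReal_add (by positivity) (by positivity), ← add_div]
  · intro ω
    refine (Rumor.absTime_le (a := 1 / 4 * ρ) (by positivity) fun t =>
      ⟨(hnet _).1, (hnet _).2.1⟩).trans (ENNReal.ofReal_le_ofReal ?_)
    have h1 : 1 ≤ n / ρ := by rw [le_div_iff₀ hρ]; linarith
    have h2 : 2 * n / (1 / 4 * ρ) = 8 * (n / ρ) := by field_simp; norm_num
    rw [h2, mul_div_assoc]
    linarith
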